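/- Let $\Phi,\phi$ be the standard normal distribution function and density. Let $S_0>0$, $r\in\mathbb R$, $T>0$, $K>0$ (valuation date $0$). For spot $s$ and volatility $\sigma>0$ the Black–Scholes call price is $s\,\Phi(d_1)-Ke^{-rT}\Phi(d_2)$ and the put price is $Ke^{-rT}\Phi(-d_2)-s\,\Phi(-d_1)$, where $d_{1,2}=\frac{\log(s/K)+rT\pm\frac12\sigma^2T}{\sigma\sqrt T}$; for $\sigma=0$ they are $(s-Ke^{-rT})^+$ and $(Ke^{-rT}-s)^+$. Let $\hat\sigma(T,K;\overline p)$ be a parametrization of implied volatility with $\eta:=\hat\sigma(T,K;\overline p)>0$. Let $\vartheta$ be an absolutely continuous, almost surely positive random variable with $\mathbb E[\vartheta]=S_0$ and finite moments up to order $2N_q$, $N_q\ge 1$, and let $\{\lambda_n,\theta_n\}_{n=1}^{N_q}$ be the Gauss quadrature weights and nodes of its distribution (the nodes are the $N_q$ roots of the orthogonal polynomial of degree $N_q$, the weights are the integrals of the Lagrange basis polynomials). The discretized spot-randomized call (put) price at $(T,K)$ is $\sum_n\lambda_n$ times the Black–Scholes call (put) price with spot $\theta_n$ and volatility $\eta$;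 the randomized spot implied volatility $\hat\sigma_s(T,K)\ge 0$ is the volatility for which the Black–Scholes price with spot $S_0$ equals this price. For $m\in\mathbb R$, $y>0$ put $$f(m,y)=S_0\Big[\Phi\Big(\tfrac{m+\frac12y^2T}{y\sqrt T}\Big)-e^{-m}\Phi\Big(\tfrac{m-\frac12y^2T}{y\sqrt T}\Big)\Big],$$ $$g(m)=S_0\sum_{n=1}^{N_q}\lambda_n\Big[\tfrac{\theta_n}{S_0}\Phi\Big(\tfrac{m+\beta_n+\frac12\eta^2T}{\eta\sqrt T}\Big)-e^{-m}\Phi\Big(\tfrac{m+\beta_n-\frac12\eta^2T}{\eta\sqrt T}\Big)\Big],\qquad \beta_n=\log(\theta_n/S_0).$$ Then there is exactly one function $P=P_{(T,K)}:\mathbb R\to(0,\infty)$ with $f(m,P(m))=g(m)$ for all $m\in\mathbb R$. It is smooth. Both for calls and for puts $\hat\sigma_s(T,K)$ exists, is unique, and equals $P(m(T,K))$ with $m(T,K)=\log(S_0/K)+rT$. As $m\to0$, $$P(m)=P(0)+P'(0)m+\tfrac{P^{(2)}(0)}{2!}m^2+\tfrac{P^{(3)}(0)}{3!}m^3+\tfrac{P^{(4)}(0)}{4!}m^4+\mathcal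 O(m^5).$$ With $d_n^\pm=\frac{\beta_n\pm\frac12\eta^2T}{\eta\sqrt T}$, $d_0^-=-\frac12P(0)\sqrt T$, $\Sigma_n=\frac{\theta_n}{S_0}\Phi(d_n^+)-\Phi(d_n^-)$, $\sigma_n=\frac{\theta_n}{S_0}\phi(d_n^+)-\phi(d_n^-)$, $\sigma_n'=\frac{\theta_n}{S_0}\phi(d_n^+)\big(\frac{\beta_n}{\eta^2T}+\frac12\big)-\phi(d_n^-)\big(\frac{\beta_n}{\eta^2T}-\frac12\big)$ and $$\Sigma_0'=-\Phi(d_0^-)+\phi(d_0^-)\Big(\tfrac1{P(0)\sqrt T}-\sqrt T\,P'(0)-\tfrac14P(0)P'(0)^2T^{3/2}\Big),$$ the first coefficients are $$P(0)=\tfrac2{\sqrt T}\Phi^{-1}\Big[\tfrac12\Big(1+\sum_n\lambda_n\Sigma_n\Big)\Big],$$ $$P'(0)=\Big[\sum_n\lambda_n\Big(\tfrac{\sigma_n}{\eta\sqrt T}+\Phi(d_n^-)\Big)-\Phi(d_0^-)\Big]\tfrac1{\sqrt T\phi(d_0^-)},$$ $$P^{(2)}(0)=\Big[\sum_n\lambda_n\Big(\tfrac{2\phi(d_n^-)-\sigma_n'}{\eta\sqrt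 T}-\Phi(d_n^-)\Big)-\Sigma_0'\Big]\tfrac1{\sqrt T\phi(d_0^-)},$$ where the argument of $\Phi^{-1}$ lies in $(0,1)$. Writing $P,P',P^{(2)},P^{(3)}$ for the values at $0$, $E_n=e^{\frac18T(P-\eta)(P+\eta)-\frac{\beta_n^2}{2T\eta^2}}\sqrt{e^{\beta_n}}$ and $W=e^{\frac{P^2T}8}\sqrt{2\pi}\Big(\Phi\big(\tfrac{P\sqrt T}2\big)-\sum_n\lambda_n\Phi\big(\tfrac{T\eta^2-2\beta_n}{2\sqrt T\eta}\big)\Big)$, the next ones are $$P^{(3)}=\tfrac1{16T^2}\Big\{\tfrac{T}{P^2}\Big(48P'+P\big(24+PT(24P^{(2)}-6PP'^2T+P'^3T(4-P^2T)+12P'(-1+PP^{(2)}T))\big)\Big)+16T^{3/2}W-\sum_n\lambda_nE_n\Big(\tfrac{24T}\eta+\tfrac{16\beta_n}{\eta^3}\Big)\Big\},$$ $$\begin{aligned}P^{(4)}=\tfrac1{64P^3T^2}\Big\{&64+T\Big(-768P'^2+384P(-P'+P^{(2)})+8P^5P'^2(P'-3P^{(2)})T^3+P^6P'^4T^4-16P^2(7+6P'^2T)\\&+32P^3T\big(P'-3P^{(2)}+4P^{(3)}-P'^2(P'-3P^{(2)})T\big)\\&+4P^4T^2\big(12(P^{(2)})^2+P'(6P'-24P^{(2)}+16P^{(3)}-3P'^3T)\big)\Big)\\&-64P^3T^{3/2}W+P^3\sum_n\lambda_nE_n\Big(\tfrac{16(-4+7T\eta^2)}{\eta^3}+\tfrac{128\beta_n}{\eta^3}+\tfrac{64\beta_n^2}{T\eta^5}\Big)\Big\}.\end{aligned}$$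 -/

import Mathlib

open MeasureTheory Filter Asymptotics
open scoped Topology ContDiff Polynomial

noncomputable section

/-! Gaussian quadrature -/

/-- `(w n, θ n)`, `n : Fin N`, are the Gauss quadrature weights and nodes with `N` points for the
distribution `μ` on the real line: the nodes are the `N` distinct roots of the degree `N`
orthogonal polynomial of `μ`, and the weights are the integrals of the Lagrange basis
polynomials at these nodes. -/
structure IsGaussQuadrature (μ : Measure ℝ) {N : ℕ} (w θ : Fin N → ℝ) : Prop where
  nodes_injective : Function.Injective θ
  nodes_orthogonal : ∀ q : ℝ[X], q.degree < (N : WithBot ℕ) →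
    ∫ x, (Lagrange.nodal Finset.univ θ).eval x * q.eval x ∂μ = 0
  weights_eq : ∀ n, w n = ∫ x, (Lagrange.basis Finset.univ θ n).eval x ∂μ

/-! The standard normal distribution -/

/-- Standard normal cumulative distribution function. -/
def stdPhi (x : ℝ) : ℝ := ProbabilityTheory.cdf (ProbabilityTheory.gaussianReal 0 1) x

/-- Standard normal density. -/
def stdDens (x : ℝ) : ℝ := ProbabilityTheory.gaussianPDFReal 0 1 x

/-- Inverse of the (injective) standard normal distribution function. It is meaningful on the
range `(0, 1)` of `stdPhi`. -/
def stdPhiInv : ℝ → ℝ := Function.invFun stdPhi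

/-! Black-Scholes prices, valuation date `0` -/

/-- The two types of vanilla European options. -/
inductive OptionType
  | call
  | put

/-- The argument `(log (s/K) + r T + σ² T / 2) / (σ √T)`. -/
def bsDPlus (r s T K σ : ℝ) : ℝ :=
  (Real.log (s / K) + r * T + σ ^ 2 * T / 2) / (σ * √T)

/-- The argument `(log (s/K) + r T - σ² T / 2) / (σ √T)`. -/
def bsDMinus (r s T K σ : ℝ) : ℝ :=
  (Real.log (s / K) + r * T - σ ^ 2 * T / 2) / (σ * √T)

/-- Black-Scholes price for rate `r`, spot `s`, expiry `T`, strike `K` and volatility `σ`. For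
`σ = 0` it is the limit as `σ` decreases to `0`, the discounted intrinsic value. -/
def bsPrice (o : OptionType) (r s T K σ : ℝ) : ℝ :=
  match o with
  | .call =>
      if σ = 0 then max (s - K * Real.exp (-(r * T))) 0
      else s * stdPhi (bsDPlus r s T K σ)
        - K * Real.exp (-(r * T)) * stdPhi (bsDMinus r s T K σ)
  | .put =>
      if σ = 0 then max (K * Real.exp (-(r * T)) - s) 0
      else K * Real.exp (-(r * T)) * stdPhi (-bsDMinus r s T K σ)
        - s * stdPhi (-bsDPlus r s T K σ)

/-- `σ ≥ 0` is a Black-Scholes implied volatility of the price `V`. -/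
def IsImpliedVol (o : OptionType) (r S₀ T K V σ : ℝ) : Prop :=
  0 ≤ σ ∧ bsPrice o r S₀ T K σ = V

/-- The discretized spot-randomized pricing surface of the volatility parametrization
`(T, K) ↦ σhat p T K`: the spot is replaced by the quadrature nodes `θ n` and the resulting
Black-Scholes prices are averaged with the weights `w n`. -/
def spotRandomizedPrice {k N : ℕ} (o : OptionType) (r : ℝ)
    (σhat : (Fin k → ℝ) → ℝ → ℝ → ℝ) (p : Fin k → ℝ) (w θ : Fin N → ℝ) (T K : ℝ) : ℝ :=
  ∑ n, w n * bsPrice o r (θ n) T K (σhat p T K)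

/-- Log-moneyness `m(T, K) = log (S₀/K) + r T`. -/
def logMoneyness (r S₀ T K : ℝ) : ℝ := Real.log (S₀ / K) + r * T

/-! The implicit equation -/

/-- Left-hand side: the Black-Scholes call price as a function of the log-moneyness `m` and the
volatility `y`. -/
def fSpot (S₀ T m y : ℝ) : ℝ :=
  S₀ * (stdPhi ((m + y ^ 2 * T / 2) / (y * √T))
    - Real.exp (-m) * stdPhi ((m - y ^ 2 * T / 2) / (y * √T)))

/-- Right-hand side: the mixture of Black-Scholes call prices with shifted log-moneyness. -/
def gSpot {N : ℕ} (S₀ T η : ℝ) (w θ : Fin N → ℝ) (m : ℝ) : ℝ :=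
  S₀ * ∑ n, w n *
    (θ n / S₀ * stdPhi ((m + Real.log (θ n / S₀) + η ^ 2 * T / 2) / (η * √T))
      - Real.exp (-m) * stdPhi ((m + Real.log (θ n / S₀) - η ^ 2 * T / 2) / (η * √T)))

/-- `P` is a positive function solving `f(m, P(m)) = g(m)` for all real `m`. -/
def SolvesSpotEquation {N : ℕ} (S₀ T η : ℝ) (w θ : Fin N → ℝ) (P : ℝ → ℝ) : Prop :=
  ∀ m, 0 < P m ∧ fSpot S₀ T m (P m) = gSpot S₀ T η w θ m

/-! Auxiliary quantities; `x` stands for a quadrature node `θ n` -/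

/-- `dₙ⁺`. -/
def dPlus (S₀ T η x : ℝ) : ℝ := (Real.log (x / S₀) + η ^ 2 * T / 2) / (η * √T)

/-- `dₙ⁻`. -/
def dMinus (S₀ T η x : ℝ) : ℝ := (Real.log (x / S₀) - η ^ 2 * T / 2) / (η * √T)

/-- `d₀⁻`. -/
def dZeroMinus (T P0 : ℝ) : ℝ := -(P0 * √T / 2)

/-- `Σₙ`, with the distribution function. -/
def bigSigma (S₀ T η x : ℝ) : ℝ :=
  x / S₀ * stdPhi (dPlus S₀ T η x) - stdPhi (dMinus S₀ T η x)

/-- The analogue of `Σₙ` with the density. -/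
def littleSigma (S₀ T η x : ℝ) : ℝ :=
  x / S₀ * stdDens (dPlus S₀ T η x) - stdDens (dMinus S₀ T η x)

/-- `Σₙ'`, with the density. -/
def littleSigma' (S₀ T η x : ℝ) : ℝ :=
  x / S₀ * stdDens (dPlus S₀ T η x) * (Real.log (x / S₀) / (η ^ 2 * T) + 1 / 2)
    - stdDens (dMinus S₀ T η x) * (Real.log (x / S₀) / (η ^ 2 * T) - 1 / 2)

/-- `Σ₀'`, in terms of `P0 = P(0)` and `P1 = P'(0)`. -/
def sigmaZero' (T P0 P1 : ℝ) : ℝ :=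
  -stdPhi (dZeroMinus T P0) + stdDens (dZeroMinus T P0) *
    (1 / (P0 * √T) - √T * P1 - 1 / 4 * P0 * P1 ^ 2 * T ^ (3 / 2 : ℝ))

/-- `exp (T (P0 - η) (P0 + η) / 8 - βₙ² / (2 T η²)) √(exp βₙ)` with `βₙ = log (θₙ/S₀)`. -/
def expWeight (S₀ T η P0 x : ℝ) : ℝ :=
  Real.exp (1 / 8 * T * (P0 - η) * (P0 + η) - Real.log (x / S₀) ^ 2 / (2 * T * η ^ 2))
    * √(Real.exp (Real.log (x / S₀)))

/-- `exp (P0² T / 8) √(2 π) (Φ(P0 √T / 2) - ∑ₙ λₙ Φ((T η² - 2 βₙ) / (2 √T η)))`. -/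
def phiDifference {N : ℕ} (S₀ T η : ℝ) (w θ : Fin N → ℝ) (P0 : ℝ) : ℝ :=
  Real.exp (P0 ^ 2 * T / 8) * √(2 * Real.pi) *
    (stdPhi (P0 * √T / 2)
      - ∑ n, w n * stdPhi ((T * η ^ 2 - 2 * Real.log (θ n / S₀)) / (2 * √T * η)))

/-! The coefficients -/

/-- The argument of `Φ⁻¹` in `P(0)`. -/
def coeffZeroArg {N : ℕ} (S₀ T η : ℝ) (w θ : Fin N → ℝ) : ℝ :=
  1 / 2 * (1 + ∑ n, w n * bigSigma S₀ T η (θ n))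

/-- `P(0)`. -/
def coeff0 {N : ℕ} (S₀ T η : ℝ) (w θ : Fin N → ℝ) : ℝ :=
  2 / √T * stdPhiInv (coeffZeroArg S₀ T η w θ)

/-- `P'(0)` in terms of `P(0)`. -/
def coeff1 {N : ℕ} (S₀ T η : ℝ) (w θ : Fin N → ℝ) (P0 : ℝ) : ℝ :=
  (∑ n, w n * (littleSigma S₀ T η (θ n) / (η * √T) + stdPhi (dMinus S₀ T η (θ n)))
      - stdPhi (dZeroMinus T P0))
    * (1 / (√T * stdDens (dZeroMinus T P0)))

/-- `P''(0)` in terms of the lower-order derivatives. -/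
def coeff2 {N : ℕ} (S₀ T η : ℝ) (w θ : Fin N → ℝ) (P0 P1 : ℝ) : ℝ :=
  (∑ n, w n * ((2 * stdDens (dMinus S₀ T η (θ n)) - littleSigma' S₀ T η (θ n)) / (η * √T)
      - stdPhi (dMinus S₀ T η (θ n))) - sigmaZero' T P0 P1)
    * (1 / (√T * stdDens (dZeroMinus T P0)))

/-- `P'''(0)` in terms of the lower-order derivatives. -/
def coeff3 {N : ℕ} (S₀ T η : ℝ) (w θ : Fin N → ℝ) (P0 P1 P2 : ℝ) : ℝ :=
  1 / (16 * T ^ 2) *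
    (T * (48 * P1 + P0 * (24 + P0 * T * (24 * P2 - 6 * P0 * P1 ^ 2 * T
          + P1 ^ 3 * T * (4 - P0 ^ 2 * T) + 12 * P1 * (-1 + P0 * P2 * T)))) / P0 ^ 2
      + 16 * T ^ (3 / 2 : ℝ) * phiDifference S₀ T η w θ P0
      - ∑ n, w n * expWeight S₀ T η P0 (θ n)
          * (24 * T / η + 16 * Real.log (θ n / S₀) / η ^ 3))

/-- `P''''(0)` in terms of the lower-order derivatives. -/
def coeff4 {N : ℕ} (S₀ T η : ℝ) (w θ : Fin N → ℝ) (P0 P1 P2 P3 : ℝ) : ℝ :=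
  1 / (64 * P0 ^ 3 * T ^ 2) *
    (64 + T * (-768 * P1 ^ 2 + 384 * P0 * (-P1 + P2)
        + 8 * P0 ^ 5 * P1 ^ 2 * (P1 - 3 * P2) * T ^ 3 + P0 ^ 6 * P1 ^ 4 * T ^ 4
        - 16 * P0 ^ 2 * (7 + 6 * P1 ^ 2 * T)
        + 32 * P0 ^ 3 * T * (P1 - 3 * P2 + 4 * P3 - P1 ^ 2 * (P1 - 3 * P2) * T)
        + 4 * P0 ^ 4 * T ^ 2 * (12 * P2 ^ 2
            + P1 * (6 * P1 - 24 * P2 + 16 * P3 - 3 * P1 ^ 3 * T)))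
      - 64 * P0 ^ 3 * T ^ (3 / 2 : ℝ) * phiDifference S₀ T η w θ P0
      + P0 ^ 3 * ∑ n, w n * expWeight S₀ T η P0 (θ n)
          * (16 * (-4 + 7 * T * η ^ 2) / η ^ 3 + 128 * Real.log (θ n / S₀) / η ^ 3
              + 64 * Real.log (θ n / S₀) ^ 2 / (T * η ^ 5)))

end

/-! The standard normal distribution function -/

/-! In units of the spot and with total volatility `v = y√T`, the equation `f(m, y) = g(m)` reads
`normCall m v = mixCall w β u m` with `u = η√T`. For fixed `m`, `normCall m` increases strictly on
`(0, ∞)` from the intrinsic value `(1 - e^{-m})⁺` to `1`. The mixture lies strictly between these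
bounds (`lt_mixCall`, `mixCall_lt_one`), so exactly one `v > 0` solves the equation. The bounds need
positive weights and nodes, total weight one and mean `S₀`; all four follow from exactness of Gauss
quadrature in degree below `2N` (`sum_eq_integral`). The last two also carry put-call parity through
the average, so puts and calls have the same implied volatility. Smoothness is the implicit function
theorem, since vega never vanishes.

For the coefficients put `V = P√T` and `D(m) = m/V - V/2`. The identity `φ(d⁺) = e^{-m} φ(d⁻)`
removes the density terms produced by `m/V`, and both sides of the differentiated equation share the
factor `e^{-m}`. What remains is `Φ(D) + φ(D) V' = ∑ wₙ Φ((m + βₙ)/u - u/2)`. Its value and first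
three derivatives at `0` determine the first four derivatives of `P`; `P(0)` comes from `normCall 0
v = 2Φ(v/2) - 1`. -/

lemma stdDens_eq (x : ℝ) : stdDens x = (√(2 * Real.pi))⁻¹ * Real.exp (-x ^ 2 / 2) := by
  simp [stdDens, ProbabilityTheory.gaussianPDFReal_def]

lemma stdDens_pos (x : ℝ) : 0 < stdDens x :=
  ProbabilityTheory.gaussianPDFReal_pos 0 1 x one_ne_zero

lemma stdDens_neg (x : ℝ) : stdDens (-x) = stdDens x := by
  simp [stdDens_eq]

lemma contDiff_stdDens {n : WithTop ℕ∞} : ContDiff ℝ n stdDens := by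
  have : stdDens = fun x => (√(2 * Real.pi))⁻¹ * Real.exp (-x ^ 2 / 2) := funext stdDens_eq
  rw [this]
  fun_prop

lemma hasDerivAt_stdDens (x : ℝ) : HasDerivAt stdDens (-x * stdDens x) x := by
  have : stdDens = fun x => (√(2 * Real.pi))⁻¹ * Real.exp (-x ^ 2 / 2) := funext stdDens_eq
  rw [this]
  have h : HasDerivAt (fun x : ℝ => -x ^ 2 / 2) (-x) x :=
    ((hasDerivAt_pow 2 x).neg.div_const 2).congr_deriv (by push_cast; ring)
  exact (h.exp.const_mul _).congr_deriv (by ring)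

lemma integrable_stdDens : Integrable stdDens :=
  ProbabilityTheory.integrable_gaussianPDFReal 0 1

lemma stdPhi_eq_integral (x : ℝ) : stdPhi x = ∫ t in Set.Iic x, stdDens t := by
  rw [stdPhi, ProbabilityTheory.cdf_eq_real, measureReal_def,
    ProbabilityTheory.gaussianReal_apply_eq_integral 0 one_ne_zero, ENNReal.toReal_ofReal]
  · rfl
  · exact integral_nonneg fun t => (stdDens_pos t).le

lemma hasDerivAt_stdPhi (x : ℝ) : HasDerivAt stdPhi (stdDens x) x := by
  have hc : Continuous stdDens := (contDiff_stdDens (n := 0)).continuous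
  have h : stdPhi = fun y => stdPhi 0 + ∫ t in (0 : ℝ)..y, stdDens t := by
    funext y
    rw [stdPhi_eq_integral, stdPhi_eq_integral,
      ← intervalIntegral.integral_Iic_sub_Iic integrable_stdDens.integrableOn
        integrable_stdDens.integrableOn]
    ring
  rw [h]
  exact (intervalIntegral.integral_hasDerivAt_right (hc.intervalIntegrable _ _)
    (hc.stronglyMeasurableAtFilter _ _) hc.continuousAt).const_add _

lemma contDiff_stdPhi {n : ℕ∞} : ContDiff ℝ n stdPhi := by
  have h : ContDiff ℝ ∞ stdPhi := by
    rw [contDiff_infty_iff_deriv]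
    refine ⟨fun x => (hasDerivAt_stdPhi x).differentiableAt, ?_⟩
    rw [funext fun x => (hasDerivAt_stdPhi x).deriv]
    exact contDiff_stdDens
  exact h.of_le (by exact_mod_cast le_top)

lemma strictMono_stdPhi : StrictMono stdPhi :=
  strictMono_of_hasDerivAt_pos hasDerivAt_stdPhi stdDens_pos

lemma tendsto_stdPhi_atTop : Tendsto stdPhi atTop (𝓝 1) :=
  ProbabilityTheory.tendsto_cdf_atTop _

lemma tendsto_stdPhi_atBot : Tendsto stdPhi atBot (𝓝 0) :=
  ProbabilityTheory.tendsto_cdf_atBot _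

lemma stdPhi_pos (x : ℝ) : 0 < stdPhi x :=
  (ProbabilityTheory.cdf_nonneg _ (x - 1)).trans_lt (strictMono_stdPhi (by linarith))

lemma stdPhi_lt_one (x : ℝ) : stdPhi x < 1 :=
  (strictMono_stdPhi (show x < x + 1 by linarith)).trans_le (ProbabilityTheory.cdf_le_one _ _)

lemma stdPhi_neg (x : ℝ) : stdPhi (-x) = 1 - stdPhi x := by
  have hd : ∀ y, HasDerivAt (fun y => stdPhi y + stdPhi (-y)) 0 y := fun y =>
    ((hasDerivAt_stdPhi y).add ((hasDerivAt_stdPhi (-y)).comp y (hasDerivAt_neg y))).congr_deriv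
      (by rw [stdDens_neg]; ring)
  have hconst : ∀ y, stdPhi y + stdPhi (-y) = stdPhi x + stdPhi (-x) := fun y =>
    is_const_of_deriv_eq_zero (fun y => (hd y).differentiableAt) (fun y => (hd y).deriv) y x
  have hlim : Tendsto (fun y => stdPhi y + stdPhi (-y)) atTop (𝓝 (1 + 0)) :=
    tendsto_stdPhi_atTop.add (tendsto_stdPhi_atBot.comp tendsto_neg_atTop_atBot)
  simp only [hconst] at hlim
  have := tendsto_nhds_unique tendsto_const_nhds hlim
  linarith

lemma stdPhiInv_stdPhi (x : ℝ) : stdPhiInv (stdPhi x) = x :=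
  Function.leftInverse_invFun strictMono_stdPhi.injective x

/-! Gauss quadrature -/

lemma Polynomial.integrable_eval_of_natDegree_le {μ : Measure ℝ} {M : ℕ}
    (hmom : ∀ i ≤ M, Integrable (fun x : ℝ => x ^ i) μ) {q : ℝ[X]} (hq : q.natDegree ≤ M) :
    Integrable (fun x => q.eval x) μ := by
  simp only [Polynomial.eval_eq_sum_range]
  refine integrable_finsetSum _ fun i hi => (hmom i ?_).const_mul _
  have := Finset.mem_range.1 hi
  omega

/-- The finitely many roots of `q` are a null set by absolute continuity, so the integrand is
positive almost everywhere. The factor `x ^ e` serves weights (`e = 0`) and nodes (`e = 1`). -/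
lemma Polynomial.integral_eval_mul_sq_pos {μ : Measure ℝ} [IsProbabilityMeasure μ] {M : ℕ}
    (hmom : ∀ i ≤ M, Integrable (fun x : ℝ => x ^ i) μ) (hac : μ ≪ volume)
    (hpos : ∀ᵐ x ∂μ, 0 < x) {e : ℕ} {q : ℝ[X]} (hq0 : q ≠ 0) (hq : e + 2 * q.natDegree ≤ M) :
    0 < ∫ x, x ^ e * q.eval x ^ 2 ∂μ := by
  have hint : Integrable (fun x => x ^ e * q.eval x ^ 2) μ := by
    have := Polynomial.integrable_eval_of_natDegree_le hmom (q := X ^ e * q ^ 2) (by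
      rw [(monic_X_pow e).natDegree_mul' (pow_ne_zero 2 hq0), natDegree_X_pow, natDegree_pow]
      exact hq)
    simpa using this
  have hne : ∀ᵐ x ∂μ, 0 < x ^ e * q.eval x ^ 2 := by
    have hroots : ∀ᵐ x ∂μ, x ∉ (q.roots.toFinset : Set ℝ) :=
      hac.ae_le (measure_eq_zero_iff_ae_notMem.1 (q.roots.toFinset.finite_toSet.measure_zero volume))
    filter_upwards [hroots, hpos] with x hx hx0
    have : q.eval x ≠ 0 := fun h => hx (by simpa [hq0] using h)
    positivity
  refine (integral_pos_iff_support_of_nonneg_ae (hne.mono fun x hx => hx.le) hint).2 ?_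
  have hsupp : Function.support (fun x => x ^ e * q.eval x ^ 2) =ᵐ[μ] Set.univ := by
    filter_upwards [hne] with x hx
    exact propext ⟨fun _ => trivial, fun _ => hx.ne'⟩
  rw [measure_congr hsupp, measure_univ]
  exact one_pos

namespace IsGaussQuadrature

variable {μ : Measure ℝ} {N : ℕ} {w θ : Fin N → ℝ}

open Polynomial in
/-- Gauss quadrature with `N` nodes is exact on polynomials of degree less than `2 N`. -/
lemma sum_eq_integral (h : IsGaussQuadrature μ w θ)
    (hmom : ∀ i ≤ 2 * N, Integrable (fun x : ℝ => x ^ i) μ) {q : ℝ[X]}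
    (hq : q.natDegree < 2 * N) : ∑ n, w n * q.eval (θ n) = ∫ x, q.eval x ∂μ := by
  have hN : 1 ≤ N := by omega
  set nod := Lagrange.nodal Finset.univ θ with hnod
  have hmonic : nod.Monic := Lagrange.nodal_monic
  have hdeg : nod.natDegree = N := by simp [hnod, Lagrange.natDegree_nodal]
  -- Division by the nodal polynomial: the quotient has degree below `N`, so orthogonality kills its
  -- contribution to the integral, while at the nodes `q` equals its remainder, which Lagrange
  -- interpolation reproduces.
  set a := q /ₘ nod
  set b := q %ₘ nod
  have hq' : b + nod * a = q := modByMonic_add_div q nod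
  have hbdeg : b.degree < (Finset.univ : Finset (Fin N)).card := by
    rw [← Lagrange.degree_nodal (R := ℝ) (v := θ)]
    exact degree_modByMonic_lt _ hmonic
  have hadeg : a.natDegree < N := by
    rw [natDegree_divByMonic _ hmonic, hdeg]; omega
  have hadeg' : a.degree < (N : WithBot ℕ) := by
    by_cases ha : a = 0
    · rw [ha, degree_zero]; exact WithBot.bot_lt_coe _
    · exact (natDegree_lt_iff_degree_lt ha).1 hadeg
  have hbnat : b.natDegree ≤ 2 * N := by
    have : b.natDegree ≤ nod.natDegree := natDegree_modByMonic_le q hmonic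
    omega
  have hint1 : Integrable (fun x => b.eval x) μ := integrable_eval_of_natDegree_le hmom hbnat
  have hint2 : Integrable (fun x => nod.eval x * a.eval x) μ := by
    have := integrable_eval_of_natDegree_le hmom (q := nod * a)
      (natDegree_mul_le.trans (by omega))
    simpa using this
  have hb : b = ∑ n, C (b.eval (θ n)) * Lagrange.basis Finset.univ θ n := by
    conv_lhs => rw [Lagrange.eq_interpolate h.nodes_injective.injOn hbdeg,
      Lagrange.interpolate_apply]
  have hnode : ∀ n, q.eval (θ n) = b.eval (θ n) := fun n => by
    rw [← hq', eval_add, eval_mul, Lagrange.eval_nodal_at_node (Finset.mem_univ n)]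
    ring
  have hbasis : ∀ n, Integrable (fun x => (Lagrange.basis Finset.univ θ n).eval x) μ := fun n =>
    integrable_eval_of_natDegree_le hmom (by
      rw [Lagrange.natDegree_basis h.nodes_injective.injOn (Finset.mem_univ n)]
      simp; omega)
  calc ∑ n, w n * q.eval (θ n)
      = ∑ n, b.eval (θ n) * ∫ x, (Lagrange.basis Finset.univ θ n).eval x ∂μ :=
        Finset.sum_congr rfl fun n _ => by rw [hnode, h.weights_eq, mul_comm]
    _ = ∫ x, ∑ n, b.eval (θ n) * (Lagrange.basis Finset.univ θ n).eval x ∂μ := by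
        rw [integral_finsetSum _ fun n _ => (hbasis n).const_mul _]
        simp only [integral_const_mul]
    _ = ∫ x, b.eval x ∂μ := by
        refine integral_congr_ae (ae_of_all _ fun x => ?_)
        conv_rhs => rw [hb]
        simp [eval_finsetSum]
    _ = ∫ x, q.eval x ∂μ := by
        have hsum : ∀ x, q.eval x = b.eval x + nod.eval x * a.eval x := fun x => by
          rw [← eval_mul, ← eval_add, hq']
        simp only [hsum]
        rw [integral_add hint1 hint2, h.nodes_orthogonal a hadeg', add_zero]

lemma sum_weights [IsProbabilityMeasure μ] (h : IsGaussQuadrature μ w θ)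
    (hN : 1 ≤ N) (hmom : ∀ i ≤ 2 * N, Integrable (fun x : ℝ => x ^ i) μ) : ∑ n, w n = 1 := by
  simpa using h.sum_eq_integral hmom (q := 1) (by simp; omega)

lemma sum_weights_mul_nodes (h : IsGaussQuadrature μ w θ) (hN : 1 ≤ N)
    (hmom : ∀ i ≤ 2 * N, Integrable (fun x : ℝ => x ^ i) μ) :
    ∑ n, w n * θ n = ∫ x, x ∂μ := by
  simpa using h.sum_eq_integral hmom (q := Polynomial.X) (by simp; omega)

open Polynomial in
-- The squared Lagrange basis polynomial has degree `2N - 2`, so exactness applies; the quadrature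
-- sum collapses to `w n` and the integral is positive.
lemma weight_pos [IsProbabilityMeasure μ] (h : IsGaussQuadrature μ w θ)
    (hmom : ∀ i ≤ 2 * N, Integrable (fun x : ℝ => x ^ i) μ) (hac : μ ≪ volume)
    (hpos : ∀ᵐ x ∂μ, 0 < x) (n : Fin N) : 0 < w n := by
  have hN : 1 ≤ N := Fin.pos n
  set l := Lagrange.basis Finset.univ θ n with hl
  have hdeg : l.natDegree = N - 1 := by
    rw [hl, Lagrange.natDegree_basis h.nodes_injective.injOn (Finset.mem_univ n)]; simp
  have hl0 : l ≠ 0 := Lagrange.basis_ne_zero h.nodes_injective.injOn (Finset.mem_univ n)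
  have hex := h.sum_eq_integral hmom (q := l ^ 2) (by rw [natDegree_pow]; omega)
  have hp := integral_eval_mul_sq_pos hmom hac hpos (e := 0) hl0 (by omega)
  simp only [eval_pow, pow_zero, one_mul] at hex hp
  rw [← hex, Finset.sum_eq_single n] at hp
  · simpa [hl, Lagrange.eval_basis_self h.nodes_injective.injOn (Finset.mem_univ n)] using hp
  · intro j _ hj
    rw [hl, Lagrange.eval_basis_of_ne hj.symm (Finset.mem_univ j)]; simp
  · simp

open Polynomial in
-- As for the weights, but with `X * l ^ 2`, whose degree `2N - 1` is the largest for which the rule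
-- is exact. This gives `w n * θ n > 0`.
lemma node_pos [IsProbabilityMeasure μ] (h : IsGaussQuadrature μ w θ)
    (hmom : ∀ i ≤ 2 * N, Integrable (fun x : ℝ => x ^ i) μ) (hac : μ ≪ volume)
    (hpos : ∀ᵐ x ∂μ, 0 < x) (n : Fin N) : 0 < θ n := by
  have hN : 1 ≤ N := Fin.pos n
  set l := Lagrange.basis Finset.univ θ n with hl
  have hdeg : l.natDegree = N - 1 := by
    rw [hl, Lagrange.natDegree_basis h.nodes_injective.injOn (Finset.mem_univ n)]; simp
  have hl0 : l ≠ 0 := Lagrange.basis_ne_zero h.nodes_injective.injOn (Finset.mem_univ n)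
  have hex := h.sum_eq_integral hmom (q := X * l ^ 2) (by
    rw [natDegree_X_mul (pow_ne_zero 2 hl0), natDegree_pow]; omega)
  have hp := integral_eval_mul_sq_pos hmom hac hpos (e := 1) hl0 (by omega)
  simp only [eval_mul, eval_X, eval_pow, pow_one] at hex hp
  rw [← hex, Finset.sum_eq_single n] at hp
  · rw [hl, Lagrange.eval_basis_self h.nodes_injective.injOn (Finset.mem_univ n)] at hp
    exact pos_of_mul_pos_right (by simpa using hp) (h.weight_pos hmom hac hpos n).le
  · intro j _ hj
    rw [hl, Lagrange.eval_basis_of_ne hj.symm (Finset.mem_univ j)]; simp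
  · simp

end IsGaussQuadrature

/-! The normalized Black-Scholes call price -/

/-- The Black-Scholes call price in units of the spot, as a function of the log-moneyness `m` and
the total volatility `v`. -/
noncomputable def normCall (m v : ℝ) : ℝ :=
  stdPhi (m / v + v / 2) - Real.exp (-m) * stdPhi (m / v - v / 2)

lemma normCall_def (m v : ℝ) :
    normCall m v = stdPhi (m / v + v / 2) - Real.exp (-m) * stdPhi (m / v - v / 2) := rfl

/-- The squares of the two arguments differ by `2m`. This is the source of all later cancellations
of density terms. -/
lemma stdDens_add_half (m : ℝ) {v : ℝ} (hv : v ≠ 0) :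
    stdDens (m / v + v / 2) = Real.exp (-m) * stdDens (m / v - v / 2) := by
  rw [stdDens_eq, stdDens_eq, mul_left_comm, ← Real.exp_add]
  congr 2
  field_simp
  ring

/-- The derivative of `M / V` enters with coefficient `φ(d⁺) - e^{-M} φ(d⁻) = 0` and drops out. One
formula thus gives vega, the slope of the mixture and the derivative along the implied volatility
curve. -/
lemma HasDerivAt.normCall {M V : ℝ → ℝ} {M' V' t : ℝ} (hM : HasDerivAt M M' t)
    (hV : HasDerivAt V V' t) (h0 : V t ≠ 0) :
    HasDerivAt (fun t => normCall (M t) (V t)) (Real.exp (-M t) *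
      (stdPhi (M t / V t - V t / 2) * M' + stdDens (M t / V t - V t / 2) * V')) t := by
  have h1 := (hasDerivAt_stdPhi _).comp t ((hM.div hV h0).add (hV.div_const 2))
  have h2 := (hasDerivAt_stdPhi _).comp t ((hM.div hV h0).sub (hV.div_const 2))
  have h3 := h1.sub (hM.neg.exp.mul h2)
  refine h3.congr_deriv ?_
  simp only [Pi.add_apply, Pi.sub_apply, Pi.div_apply, Function.comp_apply, Pi.neg_apply]
  rw [stdDens_add_half _ h0]
  ring

lemma contDiffAt_normCall {m v : ℝ} (hv : v ≠ 0) {n : ℕ∞} :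
    ContDiffAt ℝ n (fun z : ℝ × ℝ => normCall z.1 z.2) (m, v) := by
  have h1 : ContDiffAt ℝ n (fun z : ℝ × ℝ => z.1 / z.2) (m, v) :=
    contDiffAt_fst.div contDiffAt_snd hv
  have h2 : ContDiffAt ℝ n (fun z : ℝ × ℝ => z.2 / 2) (m, v) := contDiffAt_snd.div_const 2
  exact (contDiff_stdPhi.contDiffAt.comp _ (h1.add h2)).sub
    (contDiffAt_fst.neg.exp.mul (contDiff_stdPhi.contDiffAt.comp _ (h1.sub h2)))

lemma hasDerivAt_normCall_right (m : ℝ) {v : ℝ} (hv : v ≠ 0) :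
    HasDerivAt (normCall m) (Real.exp (-m) * stdDens (m / v - v / 2)) v :=
  (((hasDerivAt_const v m).normCall (hasDerivAt_id v) hv)).congr_deriv (by simp)

lemma continuousOn_normCall (m : ℝ) : ContinuousOn (normCall m) (Set.Ioi 0) := fun _ hv =>
  (hasDerivAt_normCall_right m (ne_of_gt hv)).continuousAt.continuousWithinAt

lemma strictMonoOn_normCall (m : ℝ) : StrictMonoOn (normCall m) (Set.Ioi 0) := by
  refine strictMonoOn_of_deriv_pos (convex_Ioi 0) (continuousOn_normCall m) fun v hv => ?_
  rw [interior_Ioi] at hv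
  rw [(hasDerivAt_normCall_right m (ne_of_gt hv)).deriv]
  exact mul_pos (Real.exp_pos _) (stdDens_pos _)

lemma tendsto_normCall_atTop (m : ℝ) : Tendsto (normCall m) atTop (𝓝 1) := by
  have h0 : Tendsto (fun v : ℝ => m / v) atTop (𝓝 0) := tendsto_id.const_div_atTop m
  have h2 : Tendsto (fun v : ℝ => v / 2) atTop atTop := tendsto_id.atTop_div_const two_pos
  have h3 := tendsto_stdPhi_atTop.comp (h0.add_atTop h2)
  have h4 := tendsto_stdPhi_atBot.comp (h0.add_atBot (tendsto_neg_atTop_atBot.comp h2))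
  have h5 := h3.sub (h4.const_mul (Real.exp (-m)))
  simpa [Function.comp_def, funext (normCall_def m), sub_eq_add_neg] using h5

lemma tendsto_normCall_zero (m : ℝ) :
    Tendsto (normCall m) (𝓝[>] 0) (𝓝 (max (1 - Real.exp (-m)) 0)) := by
  have hinv : Tendsto (fun v : ℝ => v⁻¹) (𝓝[>] 0) atTop := tendsto_inv_nhdsGT_zero
  have h2 : Tendsto (fun v : ℝ => v / 2) (𝓝[>] 0) (𝓝 0) := by
    have : Tendsto (fun v : ℝ => v / 2) (𝓝 0) (𝓝 (0 / 2)) := tendsto_id.div_const 2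
    rw [zero_div] at this
    exact this.mono_left nhdsWithin_le_nhds
  have h2' : Tendsto (fun v : ℝ => -(v / 2)) (𝓝[>] 0) (𝓝 0) := by simpa using h2.neg
  rcases lt_trichotomy m 0 with hm | rfl | hm
  · rw [max_eq_right (by linarith [Real.one_lt_exp_iff.2 (neg_pos.2 hm)])]
    have h1 : Tendsto (fun v : ℝ => m / v) (𝓝[>] 0) atBot := by
      simpa only [div_eq_mul_inv] using hinv.const_mul_atTop_of_neg hm
    have h3 := tendsto_stdPhi_atBot.comp (h1.atBot_add h2)
    have h4 := tendsto_stdPhi_atBot.comp (h1.atBot_add h2')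
    have h5 := h3.sub (h4.const_mul (Real.exp (-m)))
    simpa [Function.comp_def, funext (normCall_def m), sub_eq_add_neg] using h5
  · have hc := (hasDerivAt_stdPhi 0).continuousAt.tendsto
    have h5 := (hc.comp h2).sub (hc.comp h2')
    simpa [Function.comp_def, funext (normCall_def 0), sub_eq_add_neg] using h5
  · rw [max_eq_left (by linarith [Real.exp_lt_one_iff.2 (neg_lt_zero.2 hm)])]
    have h1 : Tendsto (fun v : ℝ => m / v) (𝓝[>] 0) atTop := by
      simpa only [div_eq_mul_inv] using hinv.const_mul_atTop hm
    have h3 := tendsto_stdPhi_atTop.comp (h1.atTop_add h2)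
    have h4 := tendsto_stdPhi_atTop.comp (h1.atTop_add h2')
    have h5 := h3.sub (h4.const_mul (Real.exp (-m)))
    simpa [Function.comp_def, funext (normCall_def m), sub_eq_add_neg] using h5

lemma normCall_lt_one (m : ℝ) {v : ℝ} (hv : 0 < v) : normCall m v < 1 := by
  -- A limit only yields a weak bound; moving to `v + 1` first makes it strict.
  have h1 : normCall m v < normCall m (v + 1) :=
    strictMonoOn_normCall m hv (Set.mem_Ioi.2 (by linarith)) (by linarith)
  refine h1.trans_le (ge_of_tendsto (tendsto_normCall_atTop m) ?_)
  filter_upwards [eventually_ge_atTop (v + 1)] with y hy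
  exact (strictMonoOn_normCall m).monotoneOn (Set.mem_Ioi.2 (by linarith))
    (Set.mem_Ioi.2 (by linarith)) hy

lemma lt_normCall (m : ℝ) {v : ℝ} (hv : 0 < v) : max (1 - Real.exp (-m)) 0 < normCall m v := by
  have h1 : normCall m (v / 2) < normCall m v :=
    strictMonoOn_normCall m (Set.mem_Ioi.2 (by linarith)) hv (by linarith)
  refine (le_of_tendsto (tendsto_normCall_zero m) ?_).trans_lt h1
  filter_upwards [Ioo_mem_nhdsGT (half_pos hv)] with y hy
  exact (strictMonoOn_normCall m).monotoneOn hy.1 (Set.mem_Ioi.2 (by linarith)) hy.2.le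

/-- Every price strictly between the intrinsic value and the spot has an implied volatility. -/
lemma exists_normCall_eq {m c : ℝ} (h0 : max (1 - Real.exp (-m)) 0 < c) (h1 : c < 1) :
    ∃ v, 0 < v ∧ normCall m v = c := by
  obtain ⟨a, hac, ha⟩ := (((tendsto_normCall_zero m).eventually (gt_mem_nhds h0)).and
    self_mem_nhdsWithin).exists
  obtain ⟨b, hbc, hb⟩ := (((tendsto_normCall_atTop m).eventually (lt_mem_nhds h1)).and
    (eventually_ge_atTop a)).exists
  have ha : 0 < a := ha
  obtain ⟨v, hv, hvc⟩ := intermediate_value_Icc hb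
    ((continuousOn_normCall m).mono fun x hx => lt_of_lt_of_le ha hx.1) ⟨hac.le, hbc.le⟩
  exact ⟨v, ha.trans_le hv.1, hvc⟩

/-! Mixtures of normalized call prices -/

/-- The mixture, with weights `w n`, of call prices with spots `exp (β n)`. -/
noncomputable def mixCall {N : ℕ} (w β : Fin N → ℝ) (u m : ℝ) : ℝ :=
  ∑ n, w n * (Real.exp (β n) * normCall (m + β n) u)

section Mixture

variable {N : ℕ} {w β : Fin N → ℝ} {u : ℝ}

lemma mixCall_lt_one (hw : ∀ n, 0 < w n) (hw1 : ∑ n, w n = 1)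
    (hwβ : ∑ n, w n * Real.exp (β n) = 1) (hu : 0 < u) (m : ℝ) : mixCall w β u m < 1 := by
  have hne : (Finset.univ : Finset (Fin N)).Nonempty := by
    by_contra h
    rw [Finset.not_nonempty_iff_eq_empty.1 h] at hw1
    simp at hw1
  rw [← hwβ]
  refine Finset.sum_lt_sum_of_nonempty hne fun n _ => mul_lt_mul_of_pos_left ?_ (hw n)
  exact mul_lt_of_lt_one_right (Real.exp_pos _) (normCall_lt_one _ hu)

/-- Each component exceeds its own intrinsic value, and `e^{βₙ} (1 - e^{-(m + βₙ)}) = e^{βₙ} -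
e^{-m}` averages to `1 - e^{-m}` by the two normalizations. -/
lemma lt_mixCall (hw : ∀ n, 0 < w n) (hw1 : ∑ n, w n = 1)
    (hwβ : ∑ n, w n * Real.exp (β n) = 1) (hu : 0 < u) (m : ℝ) :
    max (1 - Real.exp (-m)) 0 < mixCall w β u m := by
  have hne : (Finset.univ : Finset (Fin N)).Nonempty := by
    by_contra h
    rw [Finset.not_nonempty_iff_eq_empty.1 h] at hw1
    simp at hw1
  have key n := lt_normCall (m + β n) hu
  rw [max_lt_iff]
  constructor
  · have : 1 - Real.exp (-m) = ∑ n, w n * (Real.exp (β n) * (1 - Real.exp (-(m + β n)))) := by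
      have : ∀ n, w n * (Real.exp (β n) * (1 - Real.exp (-(m + β n))))
          = w n * Real.exp (β n) - w n * Real.exp (-m) := fun n => by
        rw [neg_add, Real.exp_add, Real.exp_neg (β n)]
        field_simp [(Real.exp_pos (β n)).ne']
      simp only [this, Finset.sum_sub_distrib, ← Finset.sum_mul, hw1, hwβ, one_mul]
    rw [this]
    exact Finset.sum_lt_sum_of_nonempty hne fun n _ => mul_lt_mul_of_pos_left
      (mul_lt_mul_of_pos_left ((le_max_left _ _).trans_lt (key n)) (Real.exp_pos _)) (hw n)
  · exact Finset.sum_pos (fun n _ => mul_pos (hw n)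
      (mul_pos (Real.exp_pos _) ((le_max_right _ _).trans_lt (key n)))) hne

lemma contDiff_mixCall (hu : u ≠ 0) {n : ℕ∞} : ContDiff ℝ n (mixCall w β u) := by
  refine ContDiff.sum fun i _ => contDiff_const.mul (contDiff_const.mul ?_)
  refine contDiff_iff_contDiffAt.2 fun m => ?_
  exact (contDiffAt_normCall (m := m + β i) hu).comp m
    (f := fun m => (m + β i, u)) (by fun_prop)

lemma hasDerivAt_mixCall (hu : u ≠ 0) (m : ℝ) :
    HasDerivAt (mixCall w β u)
      (Real.exp (-m) * ∑ n, w n * stdPhi ((m + β n) / u - u / 2)) m := by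
  have h n := ((((hasDerivAt_id m).add_const (β n)).normCall (hasDerivAt_const m u) hu).const_mul
    (Real.exp (β n))).const_mul (w n)
  refine (HasDerivAt.fun_sum fun n (_ : n ∈ Finset.univ) => h n).congr_deriv ?_
  rw [Finset.mul_sum]
  refine Finset.sum_congr rfl fun n _ => ?_
  simp only [id, neg_add, Real.exp_add, Real.exp_neg (β n)]
  field_simp [(Real.exp_pos (β n)).ne']
  ring

/-- The total implied volatility of a smooth price curve is smooth. -/
lemma contDiff_of_normCall_eq {G V : ℝ → ℝ} (hG : ContDiff ℝ ∞ G) (hV : ∀ m, 0 < V m)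
    (h : ∀ m, normCall m (V m) = G m) : ContDiff ℝ ∞ V := by
  refine contDiff_iff_contDiffAt.2 fun m => ?_
  set f : ℝ × ℝ → ℝ := fun z => normCall z.1 z.2 - G z.1
  have hf : ContDiffAt ℝ ∞ f (m, V m) :=
    (contDiffAt_normCall (hV m).ne').sub (hG.contDiffAt.comp _ contDiffAt_fst)
  have hn : (∞ : WithTop ℕ∞) ≠ 0 := by simp
  have hd : fderiv ℝ f (m, V m) (0, 1) = Real.exp (-m) * stdDens (m / V m - V m / 2) := by
    have h1 : HasDerivAt (fun y => (m, y)) ((0 : ℝ), (1 : ℝ)) (V m) :=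
      (hasDerivAt_const _ m).prodMk (hasDerivAt_id _)
    have h2 := (hf.differentiableAt hn).hasFDerivAt.comp_hasDerivAt (V m) h1
    exact h2.unique ((hasDerivAt_normCall_right m (hV m).ne').sub_const (G m))
  have hinv : (fderiv ℝ f (m, V m) ∘L .inr ℝ ℝ ℝ).IsInvertible := by
    have hne : Real.exp (-m) * stdDens (m / V m - V m / 2) ≠ 0 :=
      (mul_pos (Real.exp_pos _) (stdDens_pos _)).ne'
    refine ⟨ContinuousLinearEquiv.unitsEquivAut ℝ (Units.mk0 _ hne), ?_⟩
    ext
    simp [hd]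
  -- The implicit function is continuous with value `V m > 0` at `m`, hence positive nearby; there
  -- injectivity of the price in the volatility identifies it with `V`.
  have hlim := (hf.contDiffAt_implicitFunction hn hinv).continuousAt.tendsto
  have hself := hf.implicitFunction_apply_self hn hinv
  simp only at hlim hself
  rw [hself] at hlim
  refine (hf.contDiffAt_implicitFunction hn hinv).congr_of_eventuallyEq ?_
  filter_upwards [hf.eventually_apply_implicitFunction hn hinv,
    hlim.eventually (lt_mem_nhds (hV m))] with x hx hx0
  refine (strictMonoOn_normCall x).injOn (hV x) hx0 ?_
  simp only [f, h m, sub_self] at hx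
  rw [h x]; linarith

end Mixture

/-! Derivatives of the implied volatility -/

lemma ContDiff.hasDerivAt_iteratedDeriv {f : ℝ → ℝ} (hf : ContDiff ℝ ∞ f) (k : ℕ) (x : ℝ) :
    HasDerivAt (iteratedDeriv k f) (iteratedDeriv (k + 1) f x) x := by
  rw [iteratedDeriv_succ]
  exact (hf.differentiable_iteratedDeriv k (by exact_mod_cast ENat.natCast_lt_top k) x).hasDerivAt

lemma HasDerivAt.eq_of_forall_eq {f g : ℝ → ℝ} {f' g' x : ℝ} (hf : HasDerivAt f f' x)
    (hg : HasDerivAt g g' x) (h : ∀ y, f y = g y) : f' = g' := by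
  obtain rfl := funext h
  exact hf.unique hg

section Relations

variable {N : ℕ} {w β : Fin N → ℝ} {u : ℝ} {V : ℝ → ℝ}

lemma hasDerivAt_sum_stdPhi (k : ℝ) (x : ℝ) :
    HasDerivAt (fun m => ∑ n, w n * stdPhi ((m + β n) / u - k))
      (∑ n, w n * (stdDens ((x + β n) / u - k) / u)) x := by
  refine HasDerivAt.fun_sum fun n _ => ?_
  have h := (((hasDerivAt_id x).add_const (β n)).div_const u).sub_const k
  exact (((hasDerivAt_stdPhi _).comp x h).const_mul (w n)).congr_deriv (by simp [div_eq_mul_inv])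

lemma hasDerivAt_sum_stdDens (k : ℝ) (x : ℝ) :
    HasDerivAt (fun m => ∑ n, w n * (stdDens ((m + β n) / u - k) / u))
      (∑ n, w n * (-((x + β n) / u - k) * stdDens ((x + β n) / u - k) / u ^ 2)) x := by
  refine HasDerivAt.fun_sum fun n _ => ?_
  have h := (((hasDerivAt_id x).add_const (β n)).div_const u).sub_const k
  exact ((((hasDerivAt_stdDens _).comp x h).div_const u).const_mul (w n)).congr_deriv
    (by simp only [id]; ring)

lemma hasDerivAt_sum_mul_stdDens (k : ℝ) (x : ℝ) :
    HasDerivAt (fun m => ∑ n, w n * (-((m + β n) / u - k) * stdDens ((m + β n) / u - k) / u ^ 2))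
      (∑ n, w n * ((((x + β n) / u - k) ^ 2 - 1) * stdDens ((x + β n) / u - k) / u ^ 3)) x := by
  refine HasDerivAt.fun_sum fun n _ => ?_
  have h := (((hasDerivAt_id x).add_const (β n)).div_const u).sub_const k
  exact (((h.neg.mul ((hasDerivAt_stdDens _).comp x h)).div_const (u ^ 2)).const_mul
    (w n)).congr_deriv (by simp only [id, Function.comp_apply, Pi.neg_apply]; ring)

/-- Repeated differentiation at `0` of `Φ(D) + φ(D) V' = R`. -/
lemma deriv_relations {D V R R₁ R₂ R₃ : ℝ → ℝ} (hD : ContDiff ℝ ∞ D) (hV : ContDiff ℝ ∞ V)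
    (h : ∀ m, stdPhi (D m) + stdDens (D m) * deriv V m = R m)
    (hR : ∀ m, HasDerivAt R (R₁ m) m) (hR₁ : ∀ m, HasDerivAt R₁ (R₂ m) m)
    (hR₂ : ∀ m, HasDerivAt R₂ (R₃ m) m) {d₀ d₁ d₂ d₃ v₁ v₂ v₃ v₄ x : ℝ}
    (hd₀ : D x = d₀) (hd₁ : iteratedDeriv 1 D x = d₁) (hd₂ : iteratedDeriv 2 D x = d₂)
    (hd₃ : iteratedDeriv 3 D x = d₃) (hv₁ : iteratedDeriv 1 V x = v₁)
    (hv₂ : iteratedDeriv 2 V x = v₂) (hv₃ : iteratedDeriv 3 V x = v₃)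
    (hv₄ : iteratedDeriv 4 V x = v₄) :
    stdDens d₀ * (d₁ + v₂ - d₀ * d₁ * v₁) = R₁ x ∧
    stdDens d₀ * (d₂ + v₃ - d₁ ^ 2 * v₁ - d₀ * d₂ * v₁ - d₀ * d₁ * v₂
      - d₀ * d₁ * (d₁ + v₂ - d₀ * d₁ * v₁)) = R₂ x ∧
    stdDens d₀ * (d₃ + v₄ - 3 * d₁ * d₂ * v₁ - 2 * d₁ ^ 2 * v₂ - d₀ * d₃ * v₁ - 2 * d₀ * d₂ * v₂
      - d₀ * d₁ * v₃ - (d₁ ^ 2 + d₀ * d₂) * (d₁ + v₂ - d₀ * d₁ * v₁)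
      - 2 * d₀ * d₁ * (d₂ + v₃ - d₁ ^ 2 * v₁ - d₀ * d₂ * v₁ - d₀ * d₁ * v₂)
      + (d₀ * d₁) ^ 2 * (d₁ + v₂ - d₀ * d₁ * v₁)) = R₃ x := by
  have D0 m : HasDerivAt D (iteratedDeriv 1 D m) m := by
    simpa using hD.hasDerivAt_iteratedDeriv 0 m
  have D1 := hD.hasDerivAt_iteratedDeriv 1
  have D2 := hD.hasDerivAt_iteratedDeriv 2
  have V1 := hV.hasDerivAt_iteratedDeriv 1
  have V2 := hV.hasDerivAt_iteratedDeriv 2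
  have V3 := hV.hasDerivAt_iteratedDeriv 3
  simp only [Nat.reduceAdd] at D1 D2 V1 V2 V3
  rw [← iteratedDeriv_one] at h
  have φD m : HasDerivAt (fun m => stdDens (D m)) (-D m * stdDens (D m) * iteratedDeriv 1 D m) m :=
    (hasDerivAt_stdDens (D m)).comp m (D0 m)
  have h1 m : stdDens (D m) * (iteratedDeriv 1 D m + iteratedDeriv 2 V m
      - D m * iteratedDeriv 1 D m * iteratedDeriv 1 V m) = R₁ m :=
    HasDerivAt.eq_of_forall_eq ((((hasDerivAt_stdPhi (D m)).comp m (D0 m)).add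
      ((φD m).mul (V1 m))).congr_deriv (by ring)) (hR m) h
  -- Since `φ(D)' = -D D' φ(D)`, every further derivative keeps the form `φ(D)` times a bracket;
  -- `Q0` and `Q1` differentiate the brackets.
  have Q0 m := ((D1 m).add (V2 m)).sub (((D0 m).mul (D1 m)).mul (V1 m))
  have h2 m : stdDens (D m) * (iteratedDeriv 2 D m + iteratedDeriv 3 V m
      - iteratedDeriv 1 D m ^ 2 * iteratedDeriv 1 V m - D m * iteratedDeriv 2 D m *
        iteratedDeriv 1 V m - D m * iteratedDeriv 1 D m * iteratedDeriv 2 V m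
      - D m * iteratedDeriv 1 D m * (iteratedDeriv 1 D m + iteratedDeriv 2 V m
      - D m * iteratedDeriv 1 D m * iteratedDeriv 1 V m)) = R₂ m :=
    HasDerivAt.eq_of_forall_eq (((φD m).mul (Q0 m)).congr_deriv (by
      simp only [Pi.add_apply, Pi.sub_apply, Pi.mul_apply]; ring)) (hR₁ m) h1
  have Q1 m := (((((D2 m).add (V3 m)).sub (((D1 m).pow 2).mul (V1 m))).sub
    (((D0 m).mul (D2 m)).mul (V1 m))).sub (((D0 m).mul (D1 m)).mul (V2 m))).sub
    (((D0 m).mul (D1 m)).mul (Q0 m))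
  have h3 := HasDerivAt.eq_of_forall_eq ((φD x).mul (Q1 x)) (hR₂ x) h2
  have h1x := h1 x
  have h2x := h2 x
  simp only [Pi.add_apply, Pi.sub_apply, Pi.mul_apply, Pi.pow_apply, hd₀, hd₁, hd₂, hd₃, hv₁, hv₂,
    hv₃, hv₄] at h1x h2x h3
  refine ⟨h1x, h2x, ?_⟩
  rw [← h3]
  push_cast
  ring

/-- Derivatives at `0` of `m / V m - V m / 2`. -/
lemma iteratedDeriv_div_sub_half (hV : ContDiff ℝ ∞ V) (h0 : ∀ m, V m ≠ 0) {v₀ v₁ v₂ v₃ : ℝ}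
    (hv₀ : V 0 = v₀) (hv₁ : iteratedDeriv 1 V 0 = v₁)
    (hv₂ : iteratedDeriv 2 V 0 = v₂) (hv₃ : iteratedDeriv 3 V 0 = v₃) :
    iteratedDeriv 1 (fun m => m / V m - V m / 2) 0 = 1 / v₀ - v₁ / 2 ∧
    iteratedDeriv 2 (fun m => m / V m - V m / 2) 0 = -2 * v₁ / v₀ ^ 2 - v₂ / 2 ∧
    iteratedDeriv 3 (fun m => m / V m - V m / 2) 0
      = 3 * (2 * v₁ ^ 2 / v₀ ^ 3 - v₂ / v₀ ^ 2) - v₃ / 2 := by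
  set D : ℝ → ℝ := fun m => m / V m - V m / 2 with hDdef
  have hD : ContDiff ℝ ∞ D := (contDiff_id.div hV h0).sub (hV.div_const 2)
  have hD0 : D 0 = -v₀ / 2 := by simp only [hDdef, hv₀]; ring
  have hv : v₀ ≠ 0 := hv₀ ▸ h0 0
  have D0 m : HasDerivAt D (iteratedDeriv 1 D m) m := by
    simpa using hD.hasDerivAt_iteratedDeriv 0 m
  have D1 := hD.hasDerivAt_iteratedDeriv 1
  have D2 := hD.hasDerivAt_iteratedDeriv 2
  have V0 m : HasDerivAt V (iteratedDeriv 1 V m) m := by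
    simpa using hV.hasDerivAt_iteratedDeriv 0 m
  have V1 := hV.hasDerivAt_iteratedDeriv 1
  have V2 := hV.hasDerivAt_iteratedDeriv 2
  simp only [Nat.reduceAdd] at D1 D2 V1 V2
  -- Clearing the denominator replaces the quotient rule by Leibniz: each differentiation gives an
  -- equation linear in the next derivative of `D`.
  have h (m : ℝ) : (V * D) m = m - (V m) ^ 2 / 2 := by
    have := h0 m
    simp only [hDdef, Pi.mul_apply]
    field_simp
  have h1 m := HasDerivAt.eq_of_forall_eq ((V0 m).mul (D0 m))
    ((hasDerivAt_id m).sub (((V0 m).pow 2).div_const 2)) h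
  have h2 m := HasDerivAt.eq_of_forall_eq (((V1 m).mul (D0 m)).add ((V0 m).mul (D1 m)))
    ((hasDerivAt_const m (1 : ℝ)).sub ((V0 m).mul (V1 m))) (fun y => by
      have := h1 y; simp at this ⊢; linear_combination this)
  have h3 m := HasDerivAt.eq_of_forall_eq ((((V2 m).mul (D0 m)).add
    (((V1 m).mul (D1 m)).const_mul 2)).add ((V0 m).mul (D2 m)))
    ((((V1 m).pow 2).add ((V0 m).mul (V2 m))).neg) (fun y => by
      have := h2 y; simp at this ⊢; linear_combination this)
  have h1 := h1 0
  have h2 := h2 0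
  have h3 := h3 0
  simp only [hv₀, hv₁, hv₂, hv₃, hD0] at h1 h2 h3
  push_cast at h1 h2 h3
  have e1 : iteratedDeriv 1 D 0 = 1 / v₀ - v₁ / 2 := by
    field_simp
    linear_combination 2 * h1
  rw [e1] at h2 h3
  have e2 : iteratedDeriv 2 D 0 = -2 * v₁ / v₀ ^ 2 - v₂ / 2 := by
    field_simp at h2 ⊢
    linear_combination h2
  rw [e2] at h3
  refine ⟨e1, e2, ?_⟩
  field_simp at h3 ⊢
  linear_combination h3

end Relations

/-- Expanding to order five leaves an `o(m ^ 5)` remainder, and the fifth-order term itself is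
absorbed in the bound. -/
lemma ContDiff.sub_taylor_isBigO {f : ℝ → ℝ} (hf : ContDiff ℝ ∞ f) :
    (fun m : ℝ => f m - (f 0 + deriv f 0 * m
        + iteratedDeriv 2 f 0 / (Nat.factorial 2 : ℝ) * m ^ 2
        + iteratedDeriv 3 f 0 / (Nat.factorial 3 : ℝ) * m ^ 3
        + iteratedDeriv 4 f 0 / (Nat.factorial 4 : ℝ) * m ^ 4))
      =O[𝓝 0] (fun m : ℝ => m ^ 5) := by
  have h := (taylor_isLittleO_univ (x₀ := 0) (n := 5)
    (contDiff_infty.1 hf 5)).isBigO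
  have h2 : (fun m : ℝ => iteratedDeriv 5 f 0 / (Nat.factorial 5 : ℝ) * m ^ 5)
      =O[𝓝 0] (fun m : ℝ => m ^ 5) := (isBigO_refl _ _).const_mul_left _
  simp only [sub_zero] at h
  refine (h.add h2).congr_left fun m => ?_
  simp only [taylor_within_apply, Finset.sum_range_succ, Finset.sum_range_zero,
    iteratedDerivWithin_univ, smul_eq_mul, sub_zero, iteratedDeriv_zero, iteratedDeriv_one]
  simp only [Nat.factorial]
  push_cast
  ring

/-! ### From option prices to normalized prices -/

lemma fSpot_eq {S₀ T m y : ℝ} (hT : 0 < T) (hy : 0 < y) :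
    fSpot S₀ T m y = S₀ * normCall m (y * √T) := by
  have h : √T ≠ 0 := (Real.sqrt_pos.2 hT).ne'
  have h2 : T = √T ^ 2 := (Real.sq_sqrt hT.le).symm
  have e1 : (m + y ^ 2 * T / 2) / (y * √T) = m / (y * √T) + y * √T / 2 := by
    conv_lhs => enter [1]; rw [h2]
    field_simp
  have e2 : (m - y ^ 2 * T / 2) / (y * √T) = m / (y * √T) - y * √T / 2 := by
    conv_lhs => enter [1]; rw [h2]
    field_simp
  rw [fSpot, e1, e2, normCall]

lemma gSpot_eq {N : ℕ} {S₀ T η : ℝ} {w θ : Fin N → ℝ} (hT : 0 < T) (hS₀ : 0 < S₀) (hη : 0 < η)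
    (hθ : ∀ n, 0 < θ n) (m : ℝ) :
    gSpot S₀ T η w θ m = S₀ * mixCall w (fun n => Real.log (θ n / S₀)) (η * √T) m := by
  rw [gSpot, mixCall]
  congr 1
  refine Finset.sum_congr rfl fun n _ => ?_
  have hx : 0 < θ n / S₀ := div_pos (hθ n) hS₀
  -- Each mixture component is a unit-spot price at log-moneyness shifted by `βₙ`.
  have h := fSpot_eq (S₀ := 1) (m := m + Real.log (θ n / S₀)) hT hη
  rw [one_mul, fSpot, one_mul] at h
  rw [← h, Real.exp_log hx, neg_add, Real.exp_add, Real.exp_neg (Real.log _), Real.exp_log hx]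
  have hn := (hθ n).ne'
  field_simp

lemma solvesSpotEquation_iff {N : ℕ} {S₀ T η : ℝ} {w θ : Fin N → ℝ} (hT : 0 < T) (hS₀ : 0 < S₀)
    (hη : 0 < η) (hθ : ∀ n, 0 < θ n) {P : ℝ → ℝ} :
    SolvesSpotEquation S₀ T η w θ P ↔ ∀ m, 0 < P m ∧ normCall m (P m * √T) =
      mixCall w (fun n => Real.log (θ n / S₀)) (η * √T) m := by
  refine forall_congr' fun m => and_congr_right fun hP => ?_
  rw [fSpot_eq hT hP, gSpot_eq hT hS₀ hη hθ, mul_right_inj' hS₀.ne']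

lemma exp_neg_logMoneyness {r s T K : ℝ} (hs : 0 < s) (hK : 0 < K) :
    s * Real.exp (-logMoneyness r s T K) = K * Real.exp (-(r * T)) := by
  rw [logMoneyness, neg_add, Real.exp_add, Real.exp_neg (Real.log _), Real.exp_log (div_pos hs hK)]
  field_simp

lemma bsPrice_call {r s T K σ : ℝ} (hs : 0 < s) (hT : 0 < T) (hK : 0 < K) (hσ : 0 < σ) :
    bsPrice .call r s T K σ = s * normCall (logMoneyness r s T K) (σ * √T) := by
  have h := fSpot_eq (S₀ := s) (m := logMoneyness r s T K) hT hσ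
  rw [← h, fSpot, mul_sub, ← mul_assoc, exp_neg_logMoneyness hs hK]
  simp only [bsPrice, hσ.ne', if_false]
  rfl

lemma bsPrice_put {r s T K σ : ℝ} :
    bsPrice .put r s T K σ = bsPrice .call r s T K σ - s + K * Real.exp (-(r * T)) := by
  simp only [bsPrice]
  split_ifs
  · rcases le_total s (K * Real.exp (-(r * T))) with h | h
    · rw [max_eq_left (by linarith), max_eq_right (by linarith)]; ring
    · rw [max_eq_right (by linarith), max_eq_left (by linarith)]; ring
  · rw [stdPhi_neg, stdPhi_neg]; ring

lemma bsPrice_call_zero {r s T K : ℝ} (hs : 0 < s) (hK : 0 < K) :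
    bsPrice .call r s T K 0 = s * max (1 - Real.exp (-logMoneyness r s T K)) 0 := by
  simp only [bsPrice, if_true]
  rw [mul_max_of_nonneg _ _ hs.le, mul_sub, exp_neg_logMoneyness hs hK, mul_one, mul_zero]

section Price

variable {N k : ℕ} {S₀ r T K : ℝ} {w θ : Fin N → ℝ} {σhat : (Fin k → ℝ) → ℝ → ℝ → ℝ}
  {p : Fin k → ℝ}

lemma spotRandomizedPrice_call (hS₀ : 0 < S₀) (hT : 0 < T) (hK : 0 < K) (hη : 0 < σhat p T K)
    (hθ : ∀ n, 0 < θ n) :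
    spotRandomizedPrice .call r σhat p w θ T K = S₀ * mixCall w (fun n => Real.log (θ n / S₀))
      (σhat p T K * √T) (logMoneyness r S₀ T K) := by
  rw [spotRandomizedPrice, mixCall, Finset.mul_sum]
  refine Finset.sum_congr rfl fun n _ => ?_
  have hm : logMoneyness r (θ n) T K = logMoneyness r S₀ T K + Real.log (θ n / S₀) := by
    simp only [logMoneyness]
    rw [Real.log_div (hθ n).ne' hK.ne', Real.log_div hS₀.ne' hK.ne',
      Real.log_div (hθ n).ne' hS₀.ne']
    ring
  rw [bsPrice_call (hθ n) hT hK hη, hm, Real.exp_log (div_pos (hθ n) hS₀)]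
  field_simp

/-- Put-call parity is affine in the spot, so it survives averaging. -/
lemma spotRandomizedPrice_put (hw1 : ∑ n, w n = 1) (hwθ : ∑ n, w n * θ n = S₀) :
    spotRandomizedPrice .put r σhat p w θ T K =
      spotRandomizedPrice .call r σhat p w θ T K - S₀ + K * Real.exp (-(r * T)) := by
  simp only [spotRandomizedPrice, bsPrice_put, mul_add, mul_sub, Finset.sum_add_distrib,
    Finset.sum_sub_distrib, hwθ, ← Finset.sum_mul, hw1, one_mul]

lemma isImpliedVol_spotRandomizedPrice_iff (hS₀ : 0 < S₀) (hT : 0 < T) (hK : 0 < K)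
    (hη : 0 < σhat p T K) (hθ : ∀ n, 0 < θ n) (hw1 : ∑ n, w n = 1)
    (hwθ : ∑ n, w n * θ n = S₀) {y : ℝ} (hy : 0 < y)
    (h : normCall (logMoneyness r S₀ T K) (y * √T) = mixCall w (fun n => Real.log (θ n / S₀))
      (σhat p T K * √T) (logMoneyness r S₀ T K)) (o : OptionType) (σ : ℝ) :
    IsImpliedVol o r S₀ T K (spotRandomizedPrice o r σhat p w θ T K) σ ↔ σ = y := by
  have hτ : 0 < √T := Real.sqrt_pos.2 hT
  have hcall : IsImpliedVol .call r S₀ T K (spotRandomizedPrice .call r σhat p w θ T K) σ ↔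
      σ = y := by
    rw [IsImpliedVol, spotRandomizedPrice_call hS₀ hT hK hη hθ, ← h]
    constructor
    · rintro ⟨h0, hσ⟩
      rcases h0.eq_or_lt with rfl | h0
      -- Volatility zero is excluded because the price strictly exceeds the intrinsic value.
      · rw [bsPrice_call_zero hS₀ hK, mul_right_inj' hS₀.ne'] at hσ
        exact absurd hσ (lt_normCall _ (mul_pos hy hτ)).ne
      · rw [bsPrice_call hS₀ hT hK h0, mul_right_inj' hS₀.ne'] at hσ
        exact mul_right_cancel₀ hτ.ne'
          ((strictMonoOn_normCall _).injOn (mul_pos h0 hτ) (mul_pos hy hτ) hσ)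
    · rintro rfl
      exact ⟨hy.le, bsPrice_call hS₀ hT hK hy⟩
  cases o with
  | call => exact hcall
  | put =>
    rw [← hcall, IsImpliedVol, IsImpliedVol, spotRandomizedPrice_put hw1 hwθ, bsPrice_put,
      add_left_inj, sub_left_inj]

end Price

/-! The coefficients -/

section Coefficients

variable {N : ℕ} {S₀ T η : ℝ} {w θ : Fin N → ℝ}

lemma dMinus_eq (hT : 0 < T) (hη : 0 < η) (x : ℝ) :
    dMinus S₀ T η x = Real.log (x / S₀) / (η * √T) - η * √T / 2 := by
  have h : √T ≠ 0 := (Real.sqrt_pos.2 hT).ne'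
  have h2 : T = √T ^ 2 := (Real.sq_sqrt hT.le).symm
  rw [dMinus]
  conv_lhs => enter [1]; rw [h2]
  field_simp

lemma dPlus_eq (hT : 0 < T) (hη : 0 < η) (x : ℝ) :
    dPlus S₀ T η x = Real.log (x / S₀) / (η * √T) + η * √T / 2 := by
  have h : √T ≠ 0 := (Real.sqrt_pos.2 hT).ne'
  have h2 : T = √T ^ 2 := (Real.sq_sqrt hT.le).symm
  rw [dPlus]
  conv_lhs => enter [1]; rw [h2]
  field_simp

lemma stdDens_dPlus (hT : 0 < T) (hη : 0 < η) {x : ℝ} (hx : 0 < x / S₀) :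
    x / S₀ * stdDens (dPlus S₀ T η x) = stdDens (dMinus S₀ T η x) := by
  have h : η * √T ≠ 0 := (mul_pos hη (Real.sqrt_pos.2 hT)).ne'
  rw [dPlus_eq hT hη, dMinus_eq hT hη, stdDens_add_half _ h, Real.exp_neg, Real.exp_log hx,
    mul_inv_cancel_left₀ hx.ne']

/-- Identifies `expWeight` as the ratio `φ(dₙ⁻) / φ(d₀⁻)`, which lets `φ(d₀⁻)` cancel from the
relations. -/
lemma stdDens_dMinus_eq (hT : 0 < T) (hη : 0 < η) (P0 x : ℝ) :
    stdDens (dMinus S₀ T η x) = stdDens (dZeroMinus T P0) * expWeight S₀ T η P0 x := by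
  have h : √T ≠ 0 := (Real.sqrt_pos.2 hT).ne'
  have h2 : √T ^ 2 = T := Real.sq_sqrt hT.le
  rw [dMinus_eq hT hη, dZeroMinus, stdDens_eq, stdDens_eq, expWeight, mul_assoc, ← Real.exp_half,
    ← Real.exp_add, ← Real.exp_add]
  congr 2
  generalize √T = τ at *
  subst h2
  field_simp
  ring

/-- The prefactor in `phiDifference` is `1 / φ(d₀⁻)`; reflection and total weight one convert the
rest. -/
lemma phiDifference_eq (hT : 0 < T) (hη : 0 < η) (hw1 : ∑ n, w n = 1) (P0 : ℝ) :
    stdDens (dZeroMinus T P0) * phiDifference S₀ T η w θ P0 =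
      ∑ n, w n * stdPhi (dMinus S₀ T η (θ n)) - stdPhi (dZeroMinus T P0) := by
  have h : √T ≠ 0 := (Real.sqrt_pos.2 hT).ne'
  have h2 : √T ^ 2 = T := Real.sq_sqrt hT.le
  have e1 : stdPhi (P0 * √T / 2) = 1 - stdPhi (dZeroMinus T P0) := by
    rw [← stdPhi_neg, dZeroMinus, neg_neg]
  have e2 n : stdPhi ((T * η ^ 2 - 2 * Real.log (θ n / S₀)) / (2 * √T * η)) =
      1 - stdPhi (dMinus S₀ T η (θ n)) := by
    rw [← stdPhi_neg, dMinus]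
    congr 1
    field_simp
    ring
  have e3 : stdDens (dZeroMinus T P0) * (Real.exp (P0 ^ 2 * T / 8) * √(2 * Real.pi)) = 1 := by
    have hπ : √(2 * Real.pi) ≠ 0 := (Real.sqrt_pos.2 (by positivity)).ne'
    have e4 : P0 ^ 2 * T / 8 = -(-dZeroMinus T P0 ^ 2 / 2) := by
      rw [dZeroMinus]; nth_rw 1 [← h2]; ring
    rw [stdDens_eq, e4, Real.exp_neg]
    field_simp
  rw [phiDifference, ← mul_assoc, e3, e1]
  simp only [e2, mul_sub, mul_one, Finset.sum_sub_distrib, hw1]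
  ring

lemma coeffZeroArg_eq (hT : 0 < T) (hS₀ : 0 < S₀) (hη : 0 < η) (hθ : ∀ n, 0 < θ n) {y : ℝ}
    (h : normCall 0 y = mixCall w (fun n => Real.log (θ n / S₀)) (η * √T) 0) :
    coeffZeroArg S₀ T η w θ = stdPhi (y / 2) := by
  have hsum : ∑ n, w n * bigSigma S₀ T η (θ n) = normCall 0 y := by
    rw [h, mixCall]
    refine Finset.sum_congr rfl fun n _ => ?_
    have hx : 0 < θ n / S₀ := div_pos (hθ n) hS₀
    rw [bigSigma, normCall, zero_add, ← dPlus_eq hT hη, ← dMinus_eq hT hη, Real.exp_neg,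
      Real.exp_log hx]
    have hn := (hθ n).ne'
    field_simp
  rw [coeffZeroArg, hsum, normCall, zero_div, zero_add, zero_sub, stdPhi_neg]
  simp
  ring

/-- The relations between the derivatives at `0` determine the higher coefficients. -/
lemma third_fourth_of_relations {τ η p₀ p₁ p₂ p₃ p₄ A₀ A₁ A₂ d₀ d₁ d₂ d₃ : ℝ} (hτ : τ ≠ 0)
    (hη : η ≠ 0) (hp : p₀ ≠ 0) (hd₀ : d₀ = -(p₀ * τ) / 2)
    (hd₁ : d₁ = 1 / (p₀ * τ) - p₁ * τ / 2)
    (hd₂ : d₂ = -2 * (p₁ * τ) / (p₀ * τ) ^ 2 - p₂ * τ / 2)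
    (hd₃ : d₃ = 3 * (2 * (p₁ * τ) ^ 2 / (p₀ * τ) ^ 3 - p₂ * τ / (p₀ * τ) ^ 2) - p₃ * τ / 2)
    (h1 : d₁ + p₂ * τ - d₀ * d₁ * (p₁ * τ) = A₀ / (η * τ))
    (h2 : d₂ + p₃ * τ - d₁ ^ 2 * (p₁ * τ) - d₀ * d₂ * (p₁ * τ) - d₀ * d₁ * (p₂ * τ)
      - d₀ * d₁ * (d₁ + p₂ * τ - d₀ * d₁ * (p₁ * τ)) =
        (η * τ / 2 * A₀ - A₁ / (η * τ)) / (η * τ) ^ 2)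
    (h3 : d₃ + p₄ * τ - 3 * d₁ * d₂ * (p₁ * τ) - 2 * d₁ ^ 2 * (p₂ * τ) - d₀ * d₃ * (p₁ * τ)
      - 2 * d₀ * d₂ * (p₂ * τ) - d₀ * d₁ * (p₃ * τ)
      - (d₁ ^ 2 + d₀ * d₂) * (d₁ + p₂ * τ - d₀ * d₁ * (p₁ * τ))
      - 2 * d₀ * d₁ * (d₂ + p₃ * τ - d₁ ^ 2 * (p₁ * τ) - d₀ * d₂ * (p₁ * τ) - d₀ * d₁ * (p₂ * τ))
      + (d₀ * d₁) ^ 2 * (d₁ + p₂ * τ - d₀ * d₁ * (p₁ * τ)) =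
        (A₂ / (η * τ) ^ 2 - A₁ + (η * τ) ^ 2 / 4 * A₀ - A₀) / (η * τ) ^ 3) :
    p₃ = 1 / (16 * (τ ^ 2) ^ 2) *
      (τ ^ 2 * (48 * p₁ + p₀ * (24 + p₀ * τ ^ 2 * (24 * p₂ - 6 * p₀ * p₁ ^ 2 * τ ^ 2
            + p₁ ^ 3 * τ ^ 2 * (4 - p₀ ^ 2 * τ ^ 2) + 12 * p₁ * (-1 + p₀ * p₂ * τ ^ 2)))) / p₀ ^ 2
        + 16 * τ ^ 3 * (p₁ * τ) - (24 * τ ^ 2 / η * A₀ + 16 / η ^ 3 * A₁)) ∧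
    p₄ = 1 / (64 * p₀ ^ 3 * (τ ^ 2) ^ 2) *
      (64 + τ ^ 2 * (-768 * p₁ ^ 2 + 384 * p₀ * (-p₁ + p₂)
          + 8 * p₀ ^ 5 * p₁ ^ 2 * (p₁ - 3 * p₂) * (τ ^ 2) ^ 3 + p₀ ^ 6 * p₁ ^ 4 * (τ ^ 2) ^ 4
          - 16 * p₀ ^ 2 * (7 + 6 * p₁ ^ 2 * τ ^ 2)
          + 32 * p₀ ^ 3 * τ ^ 2 * (p₁ - 3 * p₂ + 4 * p₃ - p₁ ^ 2 * (p₁ - 3 * p₂) * τ ^ 2)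
          + 4 * p₀ ^ 4 * (τ ^ 2) ^ 2 * (12 * p₂ ^ 2
              + p₁ * (6 * p₁ - 24 * p₂ + 16 * p₃ - 3 * p₁ ^ 3 * τ ^ 2)))
        - 64 * p₀ ^ 3 * τ ^ 3 * (p₁ * τ)
        + p₀ ^ 3 * (16 * (-4 + 7 * τ ^ 2 * η ^ 2) / η ^ 3 * A₀ + 128 / η ^ 3 * A₁
            + 64 / (τ ^ 2 * η ^ 5) * A₂)) := by
  -- Each relation is linear in one new moment `Aₖ`. Solving for the moments and substituting turns
  -- both claims into rational identities in `τ`, `η` and the `pᵢ`.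
  have hA₀ : A₀ = η * τ * (d₁ + p₂ * τ - d₀ * d₁ * (p₁ * τ)) := by
    rw [h1]; field_simp
  have hA₁ : A₁ = η * τ * (η * τ / 2 * A₀ - (η * τ) ^ 2 *
      (d₂ + p₃ * τ - d₁ ^ 2 * (p₁ * τ) - d₀ * d₂ * (p₁ * τ) - d₀ * d₁ * (p₂ * τ)
      - d₀ * d₁ * (d₁ + p₂ * τ - d₀ * d₁ * (p₁ * τ)))) := by
    rw [h2]; field_simp; ring
  have hA₂ : A₂ = (η * τ) ^ 2 * ((η * τ) ^ 3 *
      (d₃ + p₄ * τ - 3 * d₁ * d₂ * (p₁ * τ) - 2 * d₁ ^ 2 * (p₂ * τ) - d₀ * d₃ * (p₁ * τ)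
      - 2 * d₀ * d₂ * (p₂ * τ) - d₀ * d₁ * (p₃ * τ)
      - (d₁ ^ 2 + d₀ * d₂) * (d₁ + p₂ * τ - d₀ * d₁ * (p₁ * τ))
      - 2 * d₀ * d₁ * (d₂ + p₃ * τ - d₁ ^ 2 * (p₁ * τ) - d₀ * d₂ * (p₁ * τ) - d₀ * d₁ * (p₂ * τ))
      + (d₀ * d₁) ^ 2 * (d₁ + p₂ * τ - d₀ * d₁ * (p₁ * τ)))
      + A₁ - (η * τ) ^ 2 / 4 * A₀ + A₀) := by
    rw [h3]; field_simp; ring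
  clear h1 h2 h3
  subst hA₂ hA₁ hA₀ hd₀ hd₁ hd₂ hd₃
  constructor
  · field_simp
    ring
  · field_simp
    ring

end Coefficients

lemma coefficients_of_normCall_eq {N : ℕ} {S₀ T η : ℝ} {w θ : Fin N → ℝ} (hT : 0 < T)
    (hS₀ : 0 < S₀) (hη : 0 < η) (hθ : ∀ n, 0 < θ n) (hw1 : ∑ n, w n = 1) {P : ℝ → ℝ}
    (hP : ContDiff ℝ ∞ P) (hP0 : ∀ m, 0 < P m)
    (h : ∀ m, normCall m (P m * √T) =
      mixCall w (fun n => Real.log (θ n / S₀)) (η * √T) m) :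
    deriv P 0 = coeff1 S₀ T η w θ (P 0) ∧
    iteratedDeriv 2 P 0 = coeff2 S₀ T η w θ (P 0) (deriv P 0) ∧
    iteratedDeriv 3 P 0 = coeff3 S₀ T η w θ (P 0) (deriv P 0) (iteratedDeriv 2 P 0) ∧
    iteratedDeriv 4 P 0 = coeff4 S₀ T η w θ (P 0) (deriv P 0) (iteratedDeriv 2 P 0)
      (iteratedDeriv 3 P 0) := by
  set V : ℝ → ℝ := fun m => P m * √T with hVdef
  have hτ : 0 < √T := Real.sqrt_pos.2 hT
  have hVpos m : 0 < V m := mul_pos (hP0 m) hτ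
  have hV : ContDiff ℝ ∞ V := hP.mul contDiff_const
  have hVk k : iteratedDeriv k V 0 = iteratedDeriv k P 0 * √T := by
    have : V = fun m => √T * P m := funext fun m => mul_comm _ _
    rw [this, iteratedDeriv_const_mul_field, mul_comm]
  set D : ℝ → ℝ := fun m => m / V m - V m / 2 with hDdef
  have hD : ContDiff ℝ ∞ D := (contDiff_id.div hV fun m => (hVpos m).ne').sub (hV.div_const 2)
  set p₀ := P 0
  set p₁ := deriv P 0
  set p₂ := iteratedDeriv 2 P 0
  set p₃ := iteratedDeriv 3 P 0
  set p₄ := iteratedDeriv 4 P 0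
  have hp0 : 0 < p₀ := hP0 0
  have hv₁ : iteratedDeriv 1 V 0 = p₁ * √T := by rw [hVk, iteratedDeriv_one]
  have hv₂ : iteratedDeriv 2 V 0 = p₂ * √T := hVk 2
  have hv₃ : iteratedDeriv 3 V 0 = p₃ * √T := hVk 3
  have hv₄ : iteratedDeriv 4 V 0 = p₄ * √T := hVk 4
  have hv₀ : V 0 = p₀ * √T := rfl
  obtain ⟨hd₁, hd₂, hd₃⟩ := iteratedDeriv_div_sub_half hV (fun m => (hVpos m).ne') hv₀ hv₁ hv₂ hv₃
  have hd₀ : D 0 = dZeroMinus T p₀ := by simp [hDdef, hVdef, dZeroMinus, p₀]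
  have hrel m : stdPhi (D m) + stdDens (D m) * deriv V m =
      ∑ n, w n * stdPhi ((m + Real.log (θ n / S₀)) / (η * √T) - η * √T / 2) := by
    have hVd : HasDerivAt V (deriv V m) m := by
      simpa [iteratedDeriv_one] using hV.hasDerivAt_iteratedDeriv 0 m
    have := HasDerivAt.eq_of_forall_eq ((hasDerivAt_id m).normCall hVd (hVpos m).ne')
      (hasDerivAt_mixCall (mul_pos hη hτ).ne' m) h
    simpa [Real.exp_ne_zero] using this
  obtain ⟨h1, h2, h3⟩ := deriv_relations hD hV hrel (hasDerivAt_sum_stdPhi _)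
    (hasDerivAt_sum_stdDens _) (hasDerivAt_sum_mul_stdDens _) hd₀ hd₁ hd₂ hd₃ hv₁ hv₂ hv₃ hv₄
  have h0 := hrel 0
  rw [← iteratedDeriv_one, hv₁, hd₀] at h0
  simp only [zero_add, ← dMinus_eq hT hη] at h0 h1 h2 h3
  have hφ := stdDens_pos (dZeroMinus T p₀)
  set φ₀ := stdDens (dZeroMinus T p₀) with hφ₀
  have hE n : stdDens (dMinus S₀ T η (θ n)) = φ₀ * expWeight S₀ T η p₀ (θ n) :=
    stdDens_dMinus_eq hT hη p₀ (θ n)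
  have hT32 : T ^ (3 / 2 : ℝ) = √T ^ 3 := by
    rw [Real.sqrt_eq_rpow, ← Real.rpow_natCast, ← Real.rpow_mul hT.le]
    norm_num
  -- The two density terms coincide, so this part of `coeff1` vanishes.
  have hls n : littleSigma S₀ T η (θ n) = 0 := by
    rw [littleSigma, stdDens_dPlus hT hη (div_pos (hθ n) hS₀), sub_self]
  have hls' n : littleSigma' S₀ T η (θ n) = stdDens (dMinus S₀ T η (θ n)) := by
    rw [littleSigma', stdDens_dPlus hT hη (div_pos (hθ n) hS₀)]
    ring
  -- This is the undifferentiated relation at `0`, divided by `φ(d₀⁻)`.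
  have hW : phiDifference S₀ T η w θ p₀ = p₁ * √T := by
    have := phiDifference_eq (S₀ := S₀) (w := w) (θ := θ) hT hη hw1 p₀
    rw [← h0, ← hφ₀, add_sub_cancel_left] at this
    exact mul_left_cancel₀ hφ.ne' this
  set A₀ := ∑ n, w n * expWeight S₀ T η p₀ (θ n) with hA₀
  set A₁ := ∑ n, w n * expWeight S₀ T η p₀ (θ n) * Real.log (θ n / S₀) with hA₁
  set A₂ := ∑ n, w n * expWeight S₀ T η p₀ (θ n) * Real.log (θ n / S₀) ^ 2 with hA₂
  have hR₁ : ∑ n, w n * (stdDens (dMinus S₀ T η (θ n)) / (η * √T)) = φ₀ * (A₀ / (η * √T)) := by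
    rw [hA₀, Finset.sum_div, Finset.mul_sum]
    refine Finset.sum_congr rfl fun n _ => ?_
    rw [hE]; ring
  have hR₂ : ∑ n, w n * (-dMinus S₀ T η (θ n) * stdDens (dMinus S₀ T η (θ n)) / (η * √T) ^ 2) =
      φ₀ * ((η * √T / 2 * A₀ - A₁ / (η * √T)) / (η * √T) ^ 2) := by
    rw [hA₀, hA₁, Finset.sum_div, Finset.mul_sum, ← Finset.sum_sub_distrib, Finset.sum_div,
      Finset.mul_sum]
    refine Finset.sum_congr rfl fun n _ => ?_
    rw [hE, dMinus_eq hT hη]; ring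
  have hR₃ : ∑ n, w n * ((dMinus S₀ T η (θ n) ^ 2 - 1) * stdDens (dMinus S₀ T η (θ n))
      / (η * √T) ^ 3) = φ₀ * ((A₂ / (η * √T) ^ 2 - A₁ + (η * √T) ^ 2 / 4 * A₀ - A₀)
        / (η * √T) ^ 3) := by
    rw [hA₀, hA₁, hA₂, Finset.sum_div, Finset.mul_sum, ← Finset.sum_sub_distrib,
      ← Finset.sum_add_distrib, ← Finset.sum_sub_distrib, Finset.sum_div, Finset.mul_sum]
    refine Finset.sum_congr rfl fun n _ => ?_
    rw [hE, dMinus_eq hT hη]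
    field_simp
    ring
  rw [hR₁, mul_right_inj' hφ.ne'] at h1
  rw [hR₂, mul_right_inj' hφ.ne'] at h2
  rw [hR₃, mul_right_inj' hφ.ne'] at h3
  have hd0 : dZeroMinus T p₀ = -(p₀ * √T) / 2 := by rw [dZeroMinus]; ring
  have hT2 : √T ^ 2 = T := Real.sq_sqrt hT.le
  obtain ⟨h34, h44⟩ := third_fourth_of_relations hτ.ne' hη.ne' hp0.ne' hd0 rfl rfl rfl h1 h2 h3
  have hS3 : ∑ n, w n * expWeight S₀ T η p₀ (θ n)
      * (24 * T / η + 16 * Real.log (θ n / S₀) / η ^ 3) = 24 * T / η * A₀ + 16 / η ^ 3 * A₁ := by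
    rw [hA₀, hA₁, Finset.mul_sum, Finset.mul_sum, ← Finset.sum_add_distrib]
    refine Finset.sum_congr rfl fun n _ => ?_
    ring
  have hS4 : ∑ n, w n * expWeight S₀ T η p₀ (θ n)
      * (16 * (-4 + 7 * T * η ^ 2) / η ^ 3 + 128 * Real.log (θ n / S₀) / η ^ 3
        + 64 * Real.log (θ n / S₀) ^ 2 / (T * η ^ 5)) =
      16 * (-4 + 7 * T * η ^ 2) / η ^ 3 * A₀ + 128 / η ^ 3 * A₁ + 64 / (T * η ^ 5) * A₂ := by
    rw [hA₀, hA₁, hA₂, Finset.mul_sum, Finset.mul_sum, Finset.mul_sum, ← Finset.sum_add_distrib,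
      ← Finset.sum_add_distrib]
    refine Finset.sum_congr rfl fun n _ => ?_
    ring
  rw [hT2] at h34 h44
  refine ⟨?_, ?_, ?_, ?_⟩
  · rw [coeff1]
    simp only [hls, zero_div, zero_add, ← h0, ← hφ₀]
    field_simp
    ring
  -- The sum is the right side of the first-order relation minus that of the undifferentiated one.
  · have hS2 : ∑ n, w n * ((2 * stdDens (dMinus S₀ T η (θ n)) - littleSigma' S₀ T η (θ n))
        / (η * √T) - stdPhi (dMinus S₀ T η (θ n))) =
        φ₀ * (A₀ / (η * √T)) - (stdPhi (dZeroMinus T p₀) + φ₀ * (p₁ * √T)) := by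
      rw [← hR₁, h0, ← Finset.sum_sub_distrib]
      refine Finset.sum_congr rfl fun n _ => ?_
      rw [hls']; ring
    rw [coeff2, hS2, ← h1, sigmaZero', ← hφ₀, hT32, hd0]
    field_simp
    ring
  · rw [coeff3, hS3, hW, hT32]
    exact h34
  · rw [coeff4, hS4, hW, hT32]
    exact h44

/-! ### The main theorem -/

theorem theorem2 {Ω : Type*} [MeasurableSpace Ω] (ℙ : Measure Ω) [IsProbabilityMeasure ℙ]
    (N : ℕ) (hN : 1 ≤ N) (S₀ r : ℝ) (hS₀ : 0 < S₀)
    -- the random spot: absolutely continuous, positive, centered at `S₀`, with finite moments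
    (ϑ : Ω → ℝ) (hϑ : Measurable ϑ) (hac : ℙ.map ϑ ≪ volume) (hpos : ∀ᵐ a ∂ℙ, 0 < ϑ a)
    (hmom : ∀ i ≤ 2 * N, Integrable (fun a => ϑ a ^ i) ℙ) (hmean : ∫ a, ϑ a ∂ℙ = S₀)
    -- its quadrature pairs
    (w θ : Fin N → ℝ) (hquad : IsGaussQuadrature (ℙ.map ϑ) w θ)
    -- the volatility parametrization, at parameter `p` and point `(T, K)`
    {k : ℕ} (σhat : (Fin k → ℝ) → ℝ → ℝ → ℝ) (p : Fin k → ℝ)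
    (T K : ℝ) (hT : 0 < T) (hK : 0 < K) (hη : 0 < σhat p T K) :
    (∃! P : ℝ → ℝ, SolvesSpotEquation S₀ T (σhat p T K) w θ P) ∧
    ∀ P : ℝ → ℝ, SolvesSpotEquation S₀ T (σhat p T K) w θ P →
      -- the implied volatility of the spot-randomized price exists, is unique, and equals `P(m(T,K))`
      (∀ (o : OptionType) (σ : ℝ),
        IsImpliedVol o r S₀ T K (spotRandomizedPrice o r σhat p w θ T K) σ ↔
          σ = P (logMoneyness r S₀ T K)) ∧
      -- Taylor expansion at `0`
      ContDiff ℝ ∞ P ∧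
      (fun m : ℝ => P m - (P 0 + deriv P 0 * m
          + iteratedDeriv 2 P 0 / (Nat.factorial 2 : ℝ) * m ^ 2
          + iteratedDeriv 3 P 0 / (Nat.factorial 3 : ℝ) * m ^ 3
          + iteratedDeriv 4 P 0 / (Nat.factorial 4 : ℝ) * m ^ 4))
        =O[𝓝 0] (fun m : ℝ => m ^ 5) ∧
      -- the coefficients
      coeffZeroArg S₀ T (σhat p T K) w θ ∈ Set.Ioo (0 : ℝ) 1 ∧
      P 0 = coeff0 S₀ T (σhat p T K) w θ ∧
      deriv P 0 = coeff1 S₀ T (σhat p T K) w θ (P 0) ∧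
      iteratedDeriv 2 P 0 = coeff2 S₀ T (σhat p T K) w θ (P 0) (deriv P 0) ∧
      iteratedDeriv 3 P 0 =
        coeff3 S₀ T (σhat p T K) w θ (P 0) (deriv P 0) (iteratedDeriv 2 P 0) ∧
      iteratedDeriv 4 P 0 =
        coeff4 S₀ T (σhat p T K) w θ (P 0) (deriv P 0) (iteratedDeriv 2 P 0)
          (iteratedDeriv 3 P 0) := by
  have hprob : IsProbabilityMeasure (ℙ.map ϑ) := Measure.isProbabilityMeasure_map hϑ.aemeasurable
  have hpos' : ∀ᵐ x ∂(ℙ.map ϑ), 0 < x := (ae_map_iff hϑ.aemeasurable measurableSet_Ioi).2 hpos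
  have hmom' : ∀ i ≤ 2 * N, Integrable (fun x : ℝ => x ^ i) (ℙ.map ϑ) := fun i hi =>
    (integrable_map_measure (by fun_prop) hϑ.aemeasurable).2 (hmom i hi)
  have hw n := hquad.weight_pos hmom' hac hpos' n
  have hθ n := hquad.node_pos hmom' hac hpos' n
  have hw1 := hquad.sum_weights hN hmom'
  have hwθ : ∑ n, w n * θ n = S₀ := by
    rw [hquad.sum_weights_mul_nodes hN hmom', integral_map hϑ.aemeasurable (by fun_prop), hmean]
  have hwβ : ∑ n, w n * Real.exp (Real.log (θ n / S₀)) = 1 := by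
    have hx n : w n * Real.exp (Real.log (θ n / S₀)) = w n * θ n / S₀ := by
      rw [Real.exp_log (div_pos (hθ n) hS₀), mul_div_assoc]
    simp only [hx, ← Finset.sum_div, hwθ, div_self hS₀.ne']
  have hτ : 0 < √T := Real.sqrt_pos.2 hT
  have hu : 0 < σhat p T K * √T := mul_pos hη hτ
  simp only [solvesSpotEquation_iff hT hS₀ hη hθ]
  constructor
  · choose V hV0 hV using fun m => exists_normCall_eq (lt_mixCall hw hw1 hwβ hu m)
      (mixCall_lt_one hw hw1 hwβ hu m)
    refine ⟨fun m => V m / √T, fun m => ⟨div_pos (hV0 m) hτ, ?_⟩, fun P hP => funext fun m => ?_⟩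
    · simp only [div_mul_cancel₀ _ hτ.ne', hV]
    · rw [eq_div_iff hτ.ne']
      exact (strictMonoOn_normCall m).injOn (mul_pos (hP m).1 hτ) (hV0 m)
        ((hP m).2.trans (hV m).symm)
  · intro P hP
    have hsmooth : ContDiff ℝ ∞ P := by
      have h := contDiff_of_normCall_eq (contDiff_mixCall hu.ne')
        (fun m => mul_pos (hP m).1 hτ) (fun m => (hP m).2)
      simpa [hτ.ne'] using h.div_const √T
    have harg := coeffZeroArg_eq hT hS₀ hη hθ (hP 0).2
    refine ⟨fun o σ => isImpliedVol_spotRandomizedPrice_iff hS₀ hT hK hη hθ hw1 hwθ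
      (hP _).1 (hP _).2 o σ, hsmooth, hsmooth.sub_taylor_isBigO, ?_, ?_,
      coefficients_of_normCall_eq hT hS₀ hη hθ hw1 hsmooth (fun m => (hP m).1)
        (fun m => (hP m).2)⟩
    · rw [harg]
      exact ⟨stdPhi_pos _, stdPhi_lt_one _⟩
    · rw [coeff0, harg, stdPhiInv_stdPhi]
      field_simp
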